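/- Let $1\le m<n$, let $N$ be a smooth $n$-manifold with a Randers metric $F=\alpha+\beta$ ($\alpha(y)=\sqrt{a(y,y)}$ for a Riemannian metric $a$, $\beta$ a one-form with $\|\beta\|_a<1$), and let $(h,W)$ be its navigation datum: $h$ is a Riemannian metric, $W$ a vector field with $\|W\|_h<1$, and $$F(y)=\frac{\sqrt{\lambda\,h(y,y)+h(W,y)^2}-h(W,y)}{\lambda},\qquad \lambda=1-\|W\|_h^2 .$$ Let $g_{ij}(x,y)=\frac12[F^2]_{y^iy^j}$, $G^i=\frac14 g^{il}\{[F^2]_{x^ky^l}y^k-[F^2]_{x^l}\}$, and let $S(x,y)=\frac{\partial G^i}{\partial y^i}-y^i\frac{\partial}{\partial x^i}\ln\sigma$ be the S-curvature with respect to the Busemann–Hausdorff volume form $\sigma\,dx^1\wedge\dots\wedge dx^n$. The S-curvature is called constant if $S=(n+1)kF$ on $TN\setminus 0$ for some constant $k\in\mathbb R$. Let $D^{w}$ be the covariant derivative of the Chern connection with reference vector $w$, and let $\mathcal L(y)=F(y)F_{y^i}(y)\,dx^i$ be the Legendre transformation. Let $\phi:M\to N$ be a smooth immersion of a smooth $m$-manifold.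 A unit normal field of $M$ in $(N,F)$ on an open set $U\subset M$ is a smooth vector field $\mathbf n$ along $\phi|_U$ with $F(\mathbf n)=1$ and $\mathcal L(\mathbf n)(d\phi X)=0$ for all $X\in TU$. The principal curvatures of $M$ in $(N,F)$ with respect to $\mathbf n$ are the $m$ eigenvalues, with multiplicity, of $A_{\mathbf n}(X)=-(D^{\mathbf n}_X\mathbf n)^{\top}$, where $\top$ is the $g_{\mathbf n}$-orthogonal projection to $TM$, and the anisotropic mean curvature is their sum. $M$ is anisotropic-minimal if the anisotropic mean curvature vanishes for all unit normal fields on open subsets of $M$. The principal curvatures of $M$ in $(N,F)$ are all constant if, for every connected open $U\subset M$ and every unit normal field $\mathbf n$ on $U$, the principal curvatures with respect to $\mathbf n$ are constant on $U$. The same notions in $(N,h)$ are defined with $h$-unit $h$-normal fields $\bar{\mathbf n}$, the Levi-Civita connection of $h$ and the $h$-orthogonal projection. 1. Suppose that $F$ has constant S-curvature. Then the principal curvatures of $M$ in $(N,F)$ are all constant if and only if the principal curvatures of $M$ in $(N,h)$ are all constant. This also holds normal field by normal field: if $U\subset M$ is open and $\mathbf n$, $\bar{\mathbf n}$ are unit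 normal fields on $U$ in $(N,F)$ and $(N,h)$ with the same conormal direction (at each point $\mathcal L(\mathbf n)$ is a positive multiple of $h(\bar{\mathbf n},\cdot)$), then the principal curvatures in $(N,F)$ with respect to $\mathbf n$ are constant on $U$ if and only if those in $(N,h)$ with respect to $\bar{\mathbf n}$ are constant on $U$. 2. Suppose that the S-curvature of $F$ vanishes. Then $M$ is anisotropic-minimal in $(N,F)$ if and only if $M$ is minimal in $(N,h)$. -/

import Mathlib

open scoped Manifold ContDiff Topology

noncomputable section

namespace Randers

/-- Coordinate space `ℝⁿ`. -/
abbrev Eu (n : ℕ) : Type := EuclideanSpace ℝ (Fin n)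

/-- The `i`-th coordinate vector of `ℝⁿ`. -/
def e {n : ℕ} (i : Fin n) : Eu n := EuclideanSpace.single i 1

/-! ### Local Finsler geometry: functions of `(u, y)`, position and direction, in a chart -/

/-- `∂f/∂xⁱ` at `(u, y)`. -/
def dx {n : ℕ} (i : Fin n) (f : Eu n → Eu n → ℝ) (u y : Eu n) : ℝ :=
  fderiv ℝ (fun u' => f u' y) u (e i)

/-- `∂f/∂yⁱ` at `(u, y)`. -/
def dy {n : ℕ} (i : Fin n) (f : Eu n → Eu n → ℝ) (u y : Eu n) : ℝ :=
  fderiv ℝ (fun y' => f u y') y (e i)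

/-- The square `F²`. -/
def sqF {n : ℕ} (F : Eu n → Eu n → ℝ) : Eu n → Eu n → ℝ := fun u y => F u y ^ 2

/-- The fundamental form `g_{ij} = ½ [F²]_{yⁱyʲ}`. -/
def fundForm {n : ℕ} (F : Eu n → Eu n → ℝ) (u y : Eu n) : Matrix (Fin n) (Fin n) ℝ :=
  Matrix.of fun i j => (1 / 2) * dy i (dy j (sqF F)) u y

/-- The geodesic coefficients `Gⁱ = ¼ gⁱˡ ([F²]_{xᵏyˡ} yᵏ - [F²]_{xˡ})`. -/
def geodCoeff {n : ℕ} (F : Eu n → Eu n → ℝ) (i : Fin n) (u y : Eu n) : ℝ :=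
  (1 / 4) * ∑ l, (fundForm F u y)⁻¹ i l *
    ((∑ k, dx k (dy l (sqF F)) u y * y k) - dx l (sqF F) u y)

/-- The nonlinear connection `Nⁱⱼ = ∂Gⁱ/∂yʲ`. -/
def nonlinConn {n : ℕ} (F : Eu n → Eu n → ℝ) (i j : Fin n) (u y : Eu n) : ℝ :=
  dy j (geodCoeff F i) u y

/-- The horizontal derivative `δ/δxʲ = ∂/∂xʲ - Nᵐⱼ ∂/∂yᵐ`. -/
def horizDeriv {n : ℕ} (F : Eu n → Eu n → ℝ) (j : Fin n) (f : Eu n → Eu n → ℝ)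
    (u y : Eu n) : ℝ :=
  dx j f u y - ∑ m, nonlinConn F m j u y * dy m f u y

/-- The coefficients `Γⁱⱼₖ(u, y)` of the Chern connection,
`Γⁱⱼₖ = ½ gⁱˡ (δ g_{lk}/δxʲ + δ g_{jl}/δxᵏ - δ g_{jk}/δxˡ)`. -/
def chern {n : ℕ} (F : Eu n → Eu n → ℝ) (u y : Eu n) (i j k : Fin n) : ℝ :=
  (1 / 2) * ∑ l, (fundForm F u y)⁻¹ i l *
    (horizDeriv F j (fun u y => fundForm F u y l k) u y
      + horizDeriv F k (fun u y => fundForm F u y j l) u y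
      - horizDeriv F l (fun u y => fundForm F u y j k) u y)

/-- The density `σ` of the Busemann-Hausdorff volume form `σ dx¹ ∧ ⋯ ∧ dxⁿ`: the ratio of the
Euclidean volumes of the Euclidean unit ball and of `{y : F(u, y) < 1}`. -/
def bhDensity {n : ℕ} (F : Eu n → Eu n → ℝ) (u : Eu n) : ℝ :=
  (MeasureTheory.volume (Metric.ball (0 : Eu n) 1)).toReal /
    (MeasureTheory.volume {y : Eu n | F u y < 1}).toReal

/-- The S-curvature with respect to the Busemann-Hausdorff volume form,
`S = ∂Gⁱ/∂yⁱ - yⁱ ∂(ln σ)/∂xⁱ`. -/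
def localS {n : ℕ} (F : Eu n → Eu n → ℝ) (u y : Eu n) : ℝ :=
  (∑ i, dy i (geodCoeff F i) u y)
    - ∑ i, y i * fderiv ℝ (fun u' => Real.log (bhDensity F u')) u (e i)

/-- The Christoffel symbols of a Riemannian metric `h_{ij}(u)`,
`½ hⁱˡ (∂ⱼ h_{lk} + ∂ₖ h_{jl} - ∂ₗ h_{jk})`. -/
def christoffel {n : ℕ} (h : Eu n → Matrix (Fin n) (Fin n) ℝ) (u : Eu n) (i j k : Fin n) : ℝ :=
  (1 / 2) * ∑ l, (h u)⁻¹ i l *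
    (fderiv ℝ (fun u' => h u' l k) u (e j)
      + fderiv ℝ (fun u' => h u' j l) u (e k)
      - fderiv ℝ (fun u' => h u' j k) u (e l))

/-! ### Charts of a manifold -/

section Charts

variable {n : ℕ} {N : Type*} [TopologicalSpace N] [ChartedSpace (Eu n) N]

/-- The components of `v ∈ T_q N` in the chart around `p`. -/
def coordVec (p q : N) (v : TangentSpace (𝓡 n) q) : Eu n :=
  mfderiv (𝓡 n) 𝓘(ℝ, Eu n) (extChartAt (𝓡 n) p) q v

/-- The tangent vector `yⁱ ∂/∂xⁱ` at the point with coordinates `u` in the chart around `p`. -/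
def chartVec (p : N) (u y : Eu n) :
    TangentSpace (𝓡 n) ((extChartAt (𝓡 n) p).symm u) :=
  mfderiv 𝓘(ℝ, Eu n) (𝓡 n) (extChartAt (𝓡 n) p).symm u y

/-- A function on `TN` written in the chart around `p`. -/
def localRep (F : ∀ x : N, TangentSpace (𝓡 n) x → ℝ) (p : N) (u y : Eu n) : ℝ :=
  F ((extChartAt (𝓡 n) p).symm u) (chartVec p u y)

/-- The coordinates of `p` in the chart around `p`. -/
def center (p : N) : Eu n := extChartAt (𝓡 n) p p

end Charts

/-! ### Randers metrics and navigation data -/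

section Metrics

variable (n : ℕ) (N : Type*) [TopologicalSpace N] [ChartedSpace (Eu n) N]
  [IsManifold (𝓡 n) ∞ N]

/-- A smooth Riemannian metric on `N`. -/
abbrev RiemMetric :=
  Bundle.ContMDiffRiemannianMetric (𝓡 n) ∞ (Eu n) (fun x : N => TangentSpace (𝓡 n) x)

/-- The data of a Randers metric `F = α + β`: a smooth Riemannian metric `a`, with
`α(y) = √(a(y, y))`, and a smooth one-form `β` of norm less than one with respect to `a`. -/
structure RandersMetric where
  /-- the Riemannian metric -/
  a : RiemMetric n N
  /-- the one-form -/
  b : ∀ x : N, TangentSpace (𝓡 n) x →L[ℝ] ℝ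
  smooth_b : ContMDiff (𝓡 n) ((𝓡 n).prod 𝓘(ℝ, Eu n →L[ℝ] ℝ)) ∞
    (fun x => Bundle.TotalSpace.mk' (Eu n →L[ℝ] ℝ)
      (E := fun x : N => TangentSpace (𝓡 n) x →L[ℝ] Bundle.Trivial N ℝ x) x (b x))
  norm_b_lt_one : ∀ (x : N) (y : TangentSpace (𝓡 n) x), y ≠ 0 → (b x y) ^ 2 < a.inner x y y

/-- A navigation datum `(h, W)`: a smooth Riemannian metric `h` and a smooth vector field `W`
with `‖W‖_h < 1`. -/
structure NavigationDatum where
  /-- the Riemannian metric -/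
  h : RiemMetric n N
  /-- the wind -/
  W : ∀ x : N, TangentSpace (𝓡 n) x
  smooth_W : ContMDiff (𝓡 n) (𝓡 n).tangent ∞ (fun x => (⟨x, W x⟩ : TangentBundle (𝓡 n) N))
  norm_W_lt_one : ∀ x : N, h.inner x (W x) (W x) < 1

end Metrics

section Structures

variable {n : ℕ} {N : Type*} [TopologicalSpace N] [ChartedSpace (Eu n) N]
  [IsManifold (𝓡 n) ∞ N]

/-- The Randers metric `F = α + β`. -/
def RandersMetric.F (R : RandersMetric n N) (x : N) (y : TangentSpace (𝓡 n) x) : ℝ :=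
  Real.sqrt (R.a.inner x y y) + R.b x y

/-- `(h, W)` is the navigation datum of `F`:
`F = (√(λ h² + W₀²) - W₀) / λ` with `λ = 1 - ‖W‖_h²`, `h² = h(y, y)`, `W₀ = h(W, y)`. -/
def RandersMetric.HasNavigationDatum (R : RandersMetric n N) (D : NavigationDatum n N) : Prop :=
  ∀ (x : N) (y : TangentSpace (𝓡 n) x),
    R.F x y =
      (Real.sqrt ((1 - D.h.inner x (D.W x) (D.W x)) * D.h.inner x y y
          + (D.h.inner x (D.W x) y) ^ 2) - D.h.inner x (D.W x) y)
        / (1 - D.h.inner x (D.W x) (D.W x))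

/-- The matrix `h_{ij}(u)` of a Riemannian metric in the chart around `p`. -/
def riemMatrix (h : RiemMetric n N) (p : N) (u : Eu n) : Matrix (Fin n) (Fin n) ℝ :=
  Matrix.of fun i j =>
    h.inner ((extChartAt (𝓡 n) p).symm u) (chartVec p u (e i)) (chartVec p u (e j))

/-- The S-curvature `S(x, y)` of `(N, F, dμ_BH)`. -/
def sCurvature (F : ∀ x : N, TangentSpace (𝓡 n) x → ℝ) (x : N) (y : TangentSpace (𝓡 n) x) : ℝ :=
  localS (localRep F x) (center x) (coordVec x x y)

/-- Constant S-curvature: `S = (n + 1) k F` on `TN ∖ 0` for a constant `k`. -/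
def HasConstantSCurvature (F : ∀ x : N, TangentSpace (𝓡 n) x → ℝ) : Prop :=
  ∃ k : ℝ, ∀ (x : N) (y : TangentSpace (𝓡 n) x), y ≠ 0 → sCurvature F x y = (n + 1) * k * F x y

/-- Vanishing S-curvature: `S = 0` on `TN ∖ 0`. -/
def HasVanishingSCurvature (F : ∀ x : N, TangentSpace (𝓡 n) x → ℝ) : Prop :=
  ∀ (x : N) (y : TangentSpace (𝓡 n) x), y ≠ 0 → sCurvature F x y = 0

/-- The Legendre transformation `L(y) = F(y) F_{yⁱ}(y) dxⁱ`, evaluated at `v`. -/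
def legendre (F : ∀ x : N, TangentSpace (𝓡 n) x → ℝ) (x : N) (y v : TangentSpace (𝓡 n) x) : ℝ :=
  ∑ i, F x y * dy i (localRep F x) (center x) (coordVec x x y) * coordVec x x v i

end Structures

/-! ### Submanifolds -/

section Submanifolds

variable {n m : ℕ} {N : Type*} [TopologicalSpace N] [ChartedSpace (Eu n) N]
  [IsManifold (𝓡 n) ∞ N]
  {M : Type*} [TopologicalSpace M] [ChartedSpace (Eu m) M]

instance finiteTangentSpace (x : M) : Module.Finite ℝ (TangentSpace (𝓡 m) x) :=
  inferInstanceAs (Module.Finite ℝ (Eu m))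

/-- `φ` is a smooth immersion. -/
def IsImmersed (n m : ℕ) {N : Type*} [TopologicalSpace N] [ChartedSpace (Eu n) N]
    {M : Type*} [TopologicalSpace M] [ChartedSpace (Eu m) M] (φ : M → N) : Prop :=
  ContMDiff (𝓡 m) (𝓡 n) ∞ φ ∧ ∀ x : M, Function.Injective (mfderiv (𝓡 m) (𝓡 n) φ x)

/-- `ν` restricts to a smooth vector field along `φ` on `U`. -/
def IsSmoothFieldOn (m : ℕ) {M : Type*} [TopologicalSpace M] [ChartedSpace (Eu m) M]
    (φ : M → N) (U : Set M) (ν : ∀ x : M, TangentSpace (𝓡 n) (φ x)) : Prop :=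
  ContMDiffOn (𝓡 m) (𝓡 n).tangent ∞ (fun x => (⟨φ x, ν x⟩ : TangentBundle (𝓡 n) N)) U

/-- The components of `dφ X` in the chart around `φ x`. -/
def pushVec (φ : M → N) (x : M) (X : TangentSpace (𝓡 m) x) : Eu n :=
  coordVec (φ x) (φ x) (mfderiv (𝓡 m) (𝓡 n) φ x X)

/-- The components of the covariant derivative of the field `ν` along `φ` in the direction `X`,
`X(νⁱ) + Γⁱⱼₖ (dφ X)ʲ νᵏ`, in the chart around `φ x`, for connection coefficients `Γ` at `φ x`. -/
def covDeriv (Γ : Fin n → Fin n → Fin n → ℝ) (φ : M → N)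
    (ν : ∀ x : M, TangentSpace (𝓡 n) (φ x)) (x : M) (X : TangentSpace (𝓡 m) x) : Eu n :=
  WithLp.toLp 2 fun i =>
    (show Eu n from
      mfderiv (𝓡 m) 𝓘(ℝ, Eu n) (fun x' => coordVec (φ x) (φ x') (ν x')) x X) i
    + ∑ j, ∑ k, Γ i j k * pushVec φ x X j * coordVec (φ x) (φ x) (ν x) k

/-- `A X = -(D_X ν)^⊤` for all `X ∈ T_x M`: the vector `A X` of `T_x M` is the tangential part of
`-D_X ν` with respect to the inner product `g` on `T_{φ x} N`, that is,
`g(dφ (A X) + D_X ν, dφ Y) = 0` for all `Y ∈ T_x M`. -/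
def IsShapeOperator (g : Matrix (Fin n) (Fin n) ℝ) (Γ : Fin n → Fin n → Fin n → ℝ) (φ : M → N)
    (ν : ∀ x : M, TangentSpace (𝓡 n) (φ x)) (x : M)
    (A : TangentSpace (𝓡 m) x →ₗ[ℝ] TangentSpace (𝓡 m) x) : Prop :=
  ∀ X Y : TangentSpace (𝓡 m) x,
    ∑ i, ∑ j, g i j * (pushVec φ x (A X) + covDeriv Γ φ ν x X : Eu n) i * pushVec φ x Y j = 0

/-- The shape operator has the eigenvalues `lam 0, …, lam (m - 1)`, with multiplicities. -/
def HasEigenvalues (g : Matrix (Fin n) (Fin n) ℝ) (Γ : Fin n → Fin n → Fin n → ℝ) (φ : M → N)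
    (ν : ∀ x : M, TangentSpace (𝓡 n) (φ x)) (x : M) (lam : Fin m → ℝ) : Prop :=
  ∃ A : TangentSpace (𝓡 m) x →ₗ[ℝ] TangentSpace (𝓡 m) x, IsShapeOperator g Γ φ ν x A ∧
    LinearMap.charpoly (R := ℝ) (M := TangentSpace (𝓡 m) x) A
      = ∏ a, (Polynomial.X - Polynomial.C (lam a))

end Submanifolds

section Finsler

variable {n m : ℕ} {N : Type*} [TopologicalSpace N] [ChartedSpace (Eu n) N]
  [IsManifold (𝓡 n) ∞ N]
  {M : Type*} [TopologicalSpace M] [ChartedSpace (Eu m) M]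

/-- `ν` is a smooth unit normal field of `φ` on `U` in `(N, F)`:
`F(ν) = 1` and `L(ν)(dφ X) = 0` for all tangent vectors `X`. -/
def IsFinslerNormal (m : ℕ) {M : Type*} [TopologicalSpace M] [ChartedSpace (Eu m) M]
    (F : ∀ x : N, TangentSpace (𝓡 n) x → ℝ) (φ : M → N) (U : Set M)
    (ν : ∀ x : M, TangentSpace (𝓡 n) (φ x)) : Prop :=
  IsSmoothFieldOn m φ U ν ∧ ∀ x ∈ U, F (φ x) (ν x) = 1 ∧
    ∀ X : TangentSpace (𝓡 m) x, legendre F (φ x) (ν x) (mfderiv (𝓡 m) (𝓡 n) φ x X) = 0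

/-- `lam` lists the principal curvatures of `φ` at `x` in `(N, F)` with respect to `ν`: the
eigenvalues of `A_ν X = -(D^ν_X ν)^⊤`, with the Chern connection with reference vector `ν` and
the tangential part with respect to `g_ν`. -/
def FinslerPrincipalCurvatures (F : ∀ x : N, TangentSpace (𝓡 n) x → ℝ) (φ : M → N)
    (ν : ∀ x : M, TangentSpace (𝓡 n) (φ x)) (x : M) (lam : Fin m → ℝ) : Prop :=
  HasEigenvalues
    (fundForm (localRep F (φ x)) (center (φ x)) (coordVec (φ x) (φ x) (ν x)))
    (chern (localRep F (φ x)) (center (φ x)) (coordVec (φ x) (φ x) (ν x)))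
    φ ν x lam

/-- The principal curvatures in `(N, F)` with respect to `ν` are constant on `U`. -/
def FinslerConstantAlong (m : ℕ) {M : Type*} [TopologicalSpace M] [ChartedSpace (Eu m) M]
    (F : ∀ x : N, TangentSpace (𝓡 n) x → ℝ) (φ : M → N) (U : Set M)
    (ν : ∀ x : M, TangentSpace (𝓡 n) (φ x)) : Prop :=
  ∃ lam : Fin m → ℝ, ∀ x ∈ U, FinslerPrincipalCurvatures F φ ν x lam

/-- All principal curvatures of `φ` in `(N, F)` are constant: they are constant with respect to
every smooth unit normal field on a connected open subset of `M`. -/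
def FinslerAllConstant (m : ℕ) {M : Type*} [TopologicalSpace M] [ChartedSpace (Eu m) M]
    (F : ∀ x : N, TangentSpace (𝓡 n) x → ℝ) (φ : M → N) : Prop :=
  ∀ (U : Set M) (ν : ∀ x : M, TangentSpace (𝓡 n) (φ x)), IsOpen U → IsConnected U →
    IsFinslerNormal m F φ U ν → FinslerConstantAlong m F φ U ν

/-- Anisotropic-minimal: the anisotropic mean curvature, the sum of the principal curvatures,
vanishes for all unit normal vectors. -/
def IsAnisotropicMinimal (m : ℕ) {M : Type*} [TopologicalSpace M] [ChartedSpace (Eu m) M]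
    (F : ∀ x : N, TangentSpace (𝓡 n) x → ℝ) (φ : M → N) : Prop :=
  ∀ (U : Set M) (ν : ∀ x : M, TangentSpace (𝓡 n) (φ x)), IsOpen U →
    IsFinslerNormal m F φ U ν → ∀ x ∈ U,
      ∃ lam : Fin m → ℝ, FinslerPrincipalCurvatures F φ ν x lam ∧ ∑ a, lam a = 0

/-- `ν` is a smooth unit normal field of `φ` on `U` in the Riemannian space `(N, h)`. -/
def IsRiemNormal (m : ℕ) {M : Type*} [TopologicalSpace M] [ChartedSpace (Eu m) M]
    (h : RiemMetric n N) (φ : M → N) (U : Set M)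
    (ν : ∀ x : M, TangentSpace (𝓡 n) (φ x)) : Prop :=
  IsSmoothFieldOn m φ U ν ∧ ∀ x ∈ U, h.inner (φ x) (ν x) (ν x) = 1 ∧
    ∀ X : TangentSpace (𝓡 m) x, h.inner (φ x) (ν x) (mfderiv (𝓡 m) (𝓡 n) φ x X) = 0

/-- `lam` lists the principal curvatures of `φ` at `x` in `(N, h)` with respect to `ν`: the
eigenvalues of `X ↦ -(∇^h_X ν)^⊤`, with the Levi-Civita connection of `h`. -/
def RiemPrincipalCurvatures (h : RiemMetric n N) (φ : M → N)
    (ν : ∀ x : M, TangentSpace (𝓡 n) (φ x)) (x : M) (lam : Fin m → ℝ) : Prop :=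
  HasEigenvalues (riemMatrix h (φ x) (center (φ x)))
    (christoffel (riemMatrix h (φ x)) (center (φ x))) φ ν x lam

/-- The principal curvatures in `(N, h)` with respect to `ν` are constant on `U`. -/
def RiemConstantAlong (m : ℕ) {M : Type*} [TopologicalSpace M] [ChartedSpace (Eu m) M]
    (h : RiemMetric n N) (φ : M → N) (U : Set M)
    (ν : ∀ x : M, TangentSpace (𝓡 n) (φ x)) : Prop :=
  ∃ lam : Fin m → ℝ, ∀ x ∈ U, RiemPrincipalCurvatures h φ ν x lam

/-- All principal curvatures of `φ` in `(N, h)` are constant: they are constant with respect to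
every smooth unit normal field on a connected open subset of `M`. -/
def RiemAllConstant (m : ℕ) {M : Type*} [TopologicalSpace M] [ChartedSpace (Eu m) M]
    (h : RiemMetric n N) (φ : M → N) : Prop :=
  ∀ (U : Set M) (ν : ∀ x : M, TangentSpace (𝓡 n) (φ x)), IsOpen U → IsConnected U →
    IsRiemNormal m h φ U ν → RiemConstantAlong m h φ U ν

/-- Minimal in `(N, h)`: the mean curvature vanishes for all unit normal vectors. -/
def IsRiemMinimal (m : ℕ) {M : Type*} [TopologicalSpace M] [ChartedSpace (Eu m) M]
    (h : RiemMetric n N) (φ : M → N) : Prop :=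
  ∀ (U : Set M) (ν : ∀ x : M, TangentSpace (𝓡 n) (φ x)), IsOpen U →
    IsRiemNormal m h φ U ν → ∀ x ∈ U,
      ∃ lam : Fin m → ℝ, RiemPrincipalCurvatures h φ ν x lam ∧ ∑ a, lam a = 0

/-- `ν` (normal for `F`) and `ν'` (normal for `h`) define the same conormal direction on `U`: the
covector `L(ν)` is a positive multiple of `h(ν', ·)`. -/
def SameConormal (F : ∀ x : N, TangentSpace (𝓡 n) x → ℝ) (h : RiemMetric n N) (φ : M → N)
    (U : Set M) (ν ν' : ∀ x : M, TangentSpace (𝓡 n) (φ x)) : Prop :=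
  ∀ x ∈ U, ∃ c : ℝ, 0 < c ∧ ∀ v : TangentSpace (𝓡 n) (φ x),
    legendre F (φ x) (ν x) v = c * h.inner (φ x) (ν' x) v

end Finsler

end Randers

end

/-! At each point the `F`-unit sphere is the `h`-unit sphere translated by `W`: `F(y) = 1` exactly
when `y - W` is `h`-unit. Differentiating `h(y - F W, y - F W) = F²` gives `dF = h(v, ·)/ρ` with `v
= y - F W` and `ρ = F + h(v, W)`. Hence the Finsler unit normals are exactly `ν' + W` with `ν'` an
`h`-unit normal, and the conormal direction determines the pair (`eq_add_of_sameConormal`).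

The S-curvature measures how far `W` is from being Killing. The fundamental form is a conformal
change of `h` up to rank-one terms, with `det g = (F/ρ)^(n+1) det h` (`det_fundForm`), and `σ =
√(det h)` because a translation preserves volume (`bhDensity_eq`). The sum `∂Gⁱ/∂yⁱ` is half the
logarithmic derivative of `det g` along the spray, so the `det h` parts cancel. The rest follows
from the Euler-Lagrange equation of the spray. The outcome is `S = -(n+1)/2 · ½(L_W h)(v, v)` for
`F(y) = 1` (`localS_eq`), so `S = (n+1)kF` forces `L_W h = -4k h` (`killing_eq`, `killing_polar`).

The core is `bil_covDeriv`. Contracted with its own reference vector, the Chern connection depends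
only on first and second derivatives of `F²` and on one spray derivative (`bil_chern`). For `X`, `Y`
tangent to the submanifold, `dF(X) = dF(Y) = 0` at the normal, so most terms vanish; homothety of
`W` then gives `g(D_X (ν' + W), Y) = ρ⁻¹ (h(∇_X ν', Y) - k h(X, Y))`. On tangent vectors `g = ρ⁻¹
h`, hence the shape operators satisfy `A_F = A_h + k` (`isShapeOperator_iff`). Principal curvatures
move by the constant `k`, which preserves constancy; for `k = 0` they coincide, and so do their
sums. -/

noncomputable section
namespace Randers

/-! ### Directional derivatives in position and direction -/

/-- The derivative of `f` in the position variable, in the direction `a`. -/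
def DX {n : ℕ} (a : Eu n) (f : Eu n → Eu n → ℝ) (u y : Eu n) : ℝ :=
  fderiv ℝ (fun u' => f u' y) u a

/-- The derivative of `f` in the direction variable, in the direction `b`. -/
def DY {n : ℕ} (b : Eu n) (f : Eu n → Eu n → ℝ) (u y : Eu n) : ℝ :=
  fderiv ℝ (fun y' => f u y') y b

/-- `f` is smooth at all `(u, y)` with `u ∈ U` and `y ≠ 0`. -/
def SmoothOn {n : ℕ} (U : Set (Eu n)) (f : Eu n → Eu n → ℝ) : Prop :=
  ContDiffOn ℝ ∞ (fun z : Eu n × Eu n => f z.1 z.2) (U ×ˢ {0}ᶜ)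

section Calculus

variable {n : ℕ} {U : Set (Eu n)} {f g : Eu n → Eu n → ℝ} {u y : Eu n}

theorem sum_smul_e (a : Eu n) : ∑ i, a i • (e i : Eu n) = a := by
  ext j
  simp [e, Pi.single_apply]

theorem isOpen_slit (hU : IsOpen U) : IsOpen (U ×ˢ ({0}ᶜ : Set (Eu n))) :=
  hU.prod isOpen_compl_singleton

theorem SmoothOn.contDiffAt (hf : SmoothOn U f) (hU : IsOpen U) (hu : u ∈ U) (hy : y ≠ 0) :
    ContDiffAt ℝ ∞ (fun z : Eu n × Eu n => f z.1 z.2) (u, y) :=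
  ContDiffOn.contDiffAt hf ((isOpen_slit hU).mem_nhds ⟨hu, hy⟩)

theorem SmoothOn.differentiableAt (hf : SmoothOn U f) (hU : IsOpen U) (hu : u ∈ U) (hy : y ≠ 0) :
    DifferentiableAt ℝ (fun z : Eu n × Eu n => f z.1 z.2) (u, y) :=
  (hf.contDiffAt hU hu hy).differentiableAt (by simp)

theorem SmoothOn.DX_eq (hf : SmoothOn U f) (hU : IsOpen U) (hu : u ∈ U) (hy : y ≠ 0) (a : Eu n) :
    DX a f u y = fderiv ℝ (fun z : Eu n × Eu n => f z.1 z.2) (u, y) (a, 0) := by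
  have h1 : HasFDerivAt (fun u' : Eu n => (u', y)) (ContinuousLinearMap.inl ℝ (Eu n) (Eu n)) u :=
    hasFDerivAt_prodMk_left u y
  have h2 := (hf.differentiableAt hU hu hy).hasFDerivAt.comp u h1
  have h3 := h2.fderiv
  unfold DX
  simp only [Function.comp_def] at h3
  rw [h3]
  simp

theorem SmoothOn.DY_eq (hf : SmoothOn U f) (hU : IsOpen U) (hu : u ∈ U) (hy : y ≠ 0) (b : Eu n) :
    DY b f u y = fderiv ℝ (fun z : Eu n × Eu n => f z.1 z.2) (u, y) (0, b) := by
  have h1 : HasFDerivAt (fun y' : Eu n => (u, y')) (ContinuousLinearMap.inr ℝ (Eu n) (Eu n)) y :=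
    hasFDerivAt_prodMk_right u y
  have h2 := (hf.differentiableAt hU hu hy).hasFDerivAt.comp y h1
  have h3 := h2.fderiv
  unfold DY
  simp only [Function.comp_def] at h3
  rw [h3]
  simp

theorem SmoothOn.fderiv_apply (hf : SmoothOn U f) (hU : IsOpen U) (p : Eu n × Eu n) :
    SmoothOn U (fun u y => fderiv ℝ (fun z : Eu n × Eu n => f z.1 z.2) (u, y) p) := by
  have h := ContDiffOn.fderiv_of_isOpen (m := ∞) hf (isOpen_slit hU) (by simp)
  exact h.clm_apply contDiffOn_const

theorem SmoothOn.congr (hf : SmoothOn U f) (h : ∀ u ∈ U, ∀ y ≠ 0, g u y = f u y) :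
    SmoothOn U g :=
  ContDiffOn.congr hf (fun z hz => h z.1 hz.1 z.2 hz.2)

theorem SmoothOn.DX (hf : SmoothOn U f) (hU : IsOpen U) (a : Eu n) : SmoothOn U (DX a f) :=
  (hf.fderiv_apply hU (a, 0)).congr (fun _ hu _ hy => hf.DX_eq hU hu hy a)

theorem SmoothOn.DY (hf : SmoothOn U f) (hU : IsOpen U) (b : Eu n) : SmoothOn U (DY b f) :=
  (hf.fderiv_apply hU (0, b)).congr (fun _ hu _ hy => hf.DY_eq hU hu hy b)

theorem DX_congr (hU : IsOpen U) (h : ∀ u ∈ U, ∀ y ≠ 0, f u y = g u y) (hu : u ∈ U) (hy : y ≠ 0)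
    (a : Eu n) : DX a f u y = DX a g u y := by
  unfold DX
  rw [Filter.EventuallyEq.fderiv_eq]
  filter_upwards [hU.mem_nhds hu] with u' hu' using h u' hu' y hy

theorem DY_congr (h : ∀ u ∈ U, ∀ y ≠ 0, f u y = g u y) (hu : u ∈ U) (hy : y ≠ 0)
    (b : Eu n) : DY b f u y = DY b g u y := by
  unfold DY
  rw [Filter.EventuallyEq.fderiv_eq]
  filter_upwards [isOpen_compl_singleton.mem_nhds hy] with y' hy' using h u hu y' hy'

theorem SmoothOn.fderiv_fderiv (hf : SmoothOn U f) (hU : IsOpen U) (hu : u ∈ U) (hy : y ≠ 0)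
    (p q : Eu n × Eu n) :
    fderiv ℝ (fun z : Eu n × Eu n => fderiv ℝ (fun z : Eu n × Eu n => f z.1 z.2) z p) (u, y) q
      = fderiv ℝ (fun z : Eu n × Eu n => fderiv ℝ (fun z : Eu n × Eu n => f z.1 z.2) z q)
        (u, y) p := by
  have hd : DifferentiableAt ℝ (fderiv ℝ (fun z : Eu n × Eu n => f z.1 z.2)) (u, y) :=
    ((hf.contDiffAt hU hu hy).fderiv_right (m := ∞) (by simp)).differentiableAt (by simp)
  have hs := (hf.contDiffAt hU hu hy).isSymmSndFDerivAt
    (by simp only [minSmoothness_of_isRCLikeNormedField]; exact WithTop.coe_le_coe.2 le_top)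
  rw [fderiv_clm_apply hd (differentiableAt_const _), fderiv_clm_apply hd (differentiableAt_const _)]
  simpa using hs q p

theorem SmoothOn.DX_DY (hf : SmoothOn U f) (hU : IsOpen U) (hu : u ∈ U) (hy : y ≠ 0)
    (a b : Eu n) : Randers.DX a (Randers.DY b f) u y = Randers.DY b (Randers.DX a f) u y := by
  rw [DX_congr hU (fun u hu y hy => hf.DY_eq hU hu hy b) hu hy,
    DY_congr (fun u hu y hy => hf.DX_eq hU hu hy a) hu hy,
    (hf.fderiv_apply hU _).DX_eq hU hu hy, (hf.fderiv_apply hU _).DY_eq hU hu hy]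
  exact hf.fderiv_fderiv hU hu hy _ _

theorem SmoothOn.DY_DY (hf : SmoothOn U f) (hU : IsOpen U) (hu : u ∈ U) (hy : y ≠ 0)
    (a b : Eu n) : Randers.DY a (Randers.DY b f) u y = Randers.DY b (Randers.DY a f) u y := by
  rw [DY_congr (fun u hu y hy => hf.DY_eq hU hu hy b) hu hy,
    DY_congr (fun u hu y hy => hf.DY_eq hU hu hy a) hu hy,
    (hf.fderiv_apply hU _).DY_eq hU hu hy, (hf.fderiv_apply hU _).DY_eq hU hu hy]
  exact hf.fderiv_fderiv hU hu hy _ _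

theorem SmoothOn.DX_DX (hf : SmoothOn U f) (hU : IsOpen U) (hu : u ∈ U) (hy : y ≠ 0)
    (a b : Eu n) : Randers.DX a (Randers.DX b f) u y = Randers.DX b (Randers.DX a f) u y := by
  rw [DX_congr hU (fun u hu y hy => hf.DX_eq hU hu hy b) hu hy,
    DX_congr hU (fun u hu y hy => hf.DX_eq hU hu hy a) hu hy,
    (hf.fderiv_apply hU _).DX_eq hU hu hy, (hf.fderiv_apply hU _).DX_eq hU hu hy]
  exact hf.fderiv_fderiv hU hu hy _ _

theorem SmoothOn.hasDerivAt (hf : SmoothOn U f) (hU : IsOpen U) {α β : ℝ → Eu n} {a b : Eu n}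
    {t : ℝ} (hα : HasDerivAt α a t) (hβ : HasDerivAt β b t) (hu : α t ∈ U) (hy : β t ≠ 0) :
    HasDerivAt (fun s => f (α s) (β s))
      (Randers.DX a f (α t) (β t) + Randers.DY b f (α t) (β t)) t := by
  have h := (hf.differentiableAt hU hu hy).hasFDerivAt.comp_hasDerivAt t (hα.prodMk hβ)
  rw [hf.DX_eq hU hu hy, hf.DY_eq hU hu hy, ← map_add, Prod.mk_add_mk, add_zero, zero_add]
  exact h

theorem DX_sum (a : Eu n) (f : Eu n → Eu n → ℝ) (u y : Eu n) :
    ∑ k, a k * dx k f u y = DX a f u y := by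
  conv_rhs => rw [← sum_smul_e a]
  simp only [DX, dx, map_sum, map_smul, smul_eq_mul]

theorem DY_sum (a : Eu n) (f : Eu n → Eu n → ℝ) (u y : Eu n) :
    ∑ k, a k * dy k f u y = DY a f u y := by
  conv_rhs => rw [← sum_smul_e a]
  simp only [DY, dy, map_sum, map_smul, smul_eq_mul]

theorem DX_zero (f : Eu n → Eu n → ℝ) (u y : Eu n) : DX 0 f u y = 0 := by simp [DX]

theorem DY_zero (f : Eu n → Eu n → ℝ) (u y : Eu n) : DY 0 f u y = 0 := by simp [DY]

theorem DX_smul (c : ℝ) (b : Eu n) (f : Eu n → Eu n → ℝ) (u y : Eu n) :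
    DX (c • b) f u y = c * DX b f u y := by simp [DX]

theorem DY_smul (c : ℝ) (b : Eu n) (f : Eu n → Eu n → ℝ) (u y : Eu n) :
    DY (c • b) f u y = c * DY b f u y := by simp [DY]

theorem hasDerivAt_coord {κ : ℝ → Eu n} {k : Eu n} {t : ℝ} (hκ : HasDerivAt κ k t) (i : Fin n) :
    HasDerivAt (fun s => κ s i) (k i) t :=
  (EuclideanSpace.proj (𝕜 := ℝ) i).hasFDerivAt.comp_hasDerivAt t hκ

/-- Once the second derivatives are commuted, `c` enters as the direction of the outermost
derivative, where linearity is immediate. -/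
theorem SmoothOn.DX_DY_sum (hf : SmoothOn U f) (hU : IsOpen U) (hu : u ∈ U) (hy : y ≠ 0)
    (a b c : Eu n) : ∑ i, c i * (Randers.DX a (dy i f) u y + Randers.DY b (dy i f) u y)
      = Randers.DX a (Randers.DY c f) u y + Randers.DY b (Randers.DY c f) u y := by
  rw [hf.DX_DY hU hu hy, hf.DY_DY hU hu hy, ← DY_sum c, ← DY_sum c, ← Finset.sum_add_distrib]
  refine Finset.sum_congr rfl fun i _ => ?_
  rw [mul_add]
  congr 2
  · exact hf.DX_DY hU hu hy a (e i)
  · exact hf.DY_DY hU hu hy b (e i)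

theorem SmoothOn.DX_DX_sum (hf : SmoothOn U f) (hU : IsOpen U) (hu : u ∈ U) (hy : y ≠ 0)
    (a b c : Eu n) : ∑ i, c i * (Randers.DX a (dx i f) u y + Randers.DY b (dx i f) u y)
      = Randers.DX a (Randers.DX c f) u y + Randers.DY b (Randers.DX c f) u y := by
  rw [hf.DX_DX hU hu hy, ← hf.DX_DY hU hu hy, ← DX_sum c, ← DX_sum c, ← Finset.sum_add_distrib]
  refine Finset.sum_congr rfl fun i _ => ?_
  rw [mul_add]
  congr 2
  · exact hf.DX_DX hU hu hy a (e i)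
  · exact (hf.DX_DY hU hu hy (e i) b).symm

/-- The direction of differentiation varies together with the point, which produces the extra term
in `k`. This is needed because the spray coefficients and the wind are themselves functions of the
point. -/
theorem SmoothOn.hasDerivAt_DY (hf : SmoothOn U f) (hU : IsOpen U) {α β κ : ℝ → Eu n}
    {a b k : Eu n} {t : ℝ} (hα : HasDerivAt α a t) (hβ : HasDerivAt β b t) (hκ : HasDerivAt κ k t)
    (hu : α t ∈ U) (hy : β t ≠ 0) :
    HasDerivAt (fun s => Randers.DY (κ s) f (α s) (β s))
      (Randers.DY k f (α t) (β t) + (Randers.DX a (Randers.DY (κ t) f) (α t) (β t)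
        + Randers.DY b (Randers.DY (κ t) f) (α t) (β t))) t := by
  have h : HasDerivAt (fun s => ∑ i, κ s i * dy i f (α s) (β s)) _ t :=
    HasDerivAt.fun_sum fun i _ =>
      (hasDerivAt_coord hκ i).mul ((hf.DY hU (e i)).hasDerivAt hU hα hβ hu hy)
  simp only [DY_sum] at h
  convert h using 1
  rw [Finset.sum_add_distrib, ← hf.DX_DY_sum hU hu hy, ← DY_sum k]
  rfl

theorem SmoothOn.hasDerivAt_DX (hf : SmoothOn U f) (hU : IsOpen U) {α β κ : ℝ → Eu n}
    {a b k : Eu n} {t : ℝ} (hα : HasDerivAt α a t) (hβ : HasDerivAt β b t) (hκ : HasDerivAt κ k t)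
    (hu : α t ∈ U) (hy : β t ≠ 0) :
    HasDerivAt (fun s => Randers.DX (κ s) f (α s) (β s))
      (Randers.DX k f (α t) (β t) + (Randers.DX a (Randers.DX (κ t) f) (α t) (β t)
        + Randers.DY b (Randers.DX (κ t) f) (α t) (β t))) t := by
  have h : HasDerivAt (fun s => ∑ i, κ s i * dx i f (α s) (β s)) _ t :=
    HasDerivAt.fun_sum fun i _ =>
      (hasDerivAt_coord hκ i).mul ((hf.DX hU (e i)).hasDerivAt hU hα hβ hu hy)
  simp only [DX_sum] at h
  convert h using 1
  rw [Finset.sum_add_distrib, ← hf.DX_DX_sum hU hu hy, ← DX_sum k]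
  rfl

theorem hasDerivAt_line (u a : Eu n) (t : ℝ) : HasDerivAt (fun s : ℝ => u + s • a) a t := by
  simpa using ((hasDerivAt_id t).smul_const a).const_add u

/-- To compute `DX a f + DY b f`, differentiate along a line. -/
theorem SmoothOn.DX_add_DY_eq (hf : SmoothOn U f) (hU : IsOpen U) (hu : u ∈ U) (hy : y ≠ 0)
    {a b : Eu n} {d : ℝ} (h : HasDerivAt (fun s : ℝ => f (u + s • a) (y + s • b)) d 0) :
    Randers.DX a f u y + Randers.DY b f u y = d := by
  have h1 := hf.hasDerivAt hU (hasDerivAt_line u a 0) (hasDerivAt_line y b 0)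
    (by simpa using hu) (by simpa using hy)
  simpa using h1.unique h

/-- The derivative of `f` in the direction `(a, b)`. -/
def DZ (a b : Eu n) (f : Eu n → Eu n → ℝ) (u y : Eu n) : ℝ :=
  Randers.DX a f u y + Randers.DY b f u y

theorem SmoothOn.DZ_eq (hf : SmoothOn U f) (hU : IsOpen U) (hu : u ∈ U) (hy : y ≠ 0)
    {a b : Eu n} {d : ℝ} (h : HasDerivAt (fun s : ℝ => f (u + s • a) (y + s • b)) d 0) :
    DZ a b f u y = d := hf.DX_add_DY_eq hU hu hy h

theorem SmoothOn.hasDerivAt_line (hf : SmoothOn U f) (hU : IsOpen U) (hu : u ∈ U) (hy : y ≠ 0)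
    (a b : Eu n) : HasDerivAt (fun s : ℝ => f (u + s • a) (y + s • b)) (DZ a b f u y) 0 := by
  simpa [DZ] using hf.hasDerivAt hU (Randers.hasDerivAt_line u a 0) (Randers.hasDerivAt_line y b 0)
    (by simpa using hu) (by simpa using hy)

theorem DZ_congr (hU : IsOpen U) (h : ∀ u ∈ U, ∀ y ≠ 0, f u y = g u y) (hu : u ∈ U) (hy : y ≠ 0)
    (a b : Eu n) : DZ a b f u y = DZ a b g u y := by
  rw [DZ, DZ, DX_congr hU h hu hy, DY_congr h hu hy]

theorem DZ_zero_right (a : Eu n) : DZ a 0 f u y = Randers.DX a f u y := by simp [DZ, DY_zero]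

theorem DZ_zero_left (b : Eu n) : DZ 0 b f u y = Randers.DY b f u y := by simp [DZ, DX_zero]

/-! ### Homogeneous functions -/

/-- `f` is positively homogeneous of degree `r` in the direction variable. -/
def HomogOn (U : Set (Eu n)) (r : ℤ) (f : Eu n → Eu n → ℝ) : Prop :=
  ∀ u ∈ U, ∀ y ≠ 0, ∀ t : ℝ, 0 < t → f u (t • y) = t ^ r * f u y

/-- Along `y + s • y = (1 + s) • y` homogeneity makes `f` equal to `(1 + s) ^ r` times a constant;
differentiate at `s = 0`. -/
theorem HomogOn.euler {r : ℤ} (h : HomogOn U r f) (hf : SmoothOn U f) (hU : IsOpen U)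
    (hu : u ∈ U) (hy : y ≠ 0) : Randers.DY y f u y = r * f u y := by
  have h1 : HasDerivAt (fun s : ℝ => f (u + s • (0 : Eu n)) (y + s • y)) (r * f u y) 0 := by
    have h2 : HasDerivAt (fun s : ℝ => (1 + s) ^ r * f u y) (r * f u y) 0 := by
      have h3 : HasDerivAt (fun s : ℝ => (1 + s) ^ r) (r : ℝ) 0 := by
        have h4 := (hasDerivAt_zpow r (1 + (0 : ℝ)) (by simp)).comp (0 : ℝ)
          ((hasDerivAt_id (0 : ℝ)).const_add 1)
        simpa [Function.comp_def] using h4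
      exact h3.mul_const _
    refine h2.congr_of_eventuallyEq ?_
    filter_upwards [Ioi_mem_nhds (show (-1 : ℝ) < 0 by norm_num)] with s hs
    rw [← h u hu y hy (1 + s) (by simp only [Set.mem_Ioi] at hs; linarith)]
    simp [add_smul]
  have h2 := hf.DX_add_DY_eq hU hu hy h1
  rwa [DX_zero, zero_add] at h2

theorem HomogOn.DX {r : ℤ} (h : HomogOn U r f) (hU : IsOpen U) (a : Eu n) :
    HomogOn U r (DX a f) := by
  intro u hu y hy t ht
  unfold Randers.DX
  have : (fun u' => f u' (t • y)) =ᶠ[𝓝 u] fun u' => t ^ r * f u' y := by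
    filter_upwards [hU.mem_nhds hu] with u' hu' using h u' hu' y hy t ht
  rw [this.fderiv_eq]
  change fderiv ℝ ((t ^ r : ℝ) • fun u' => f u' y) u a = _
  rw [fderiv_const_smul_field]
  simp

theorem HomogOn.DY {r : ℤ} (h : HomogOn U r f) (b : Eu n) :
    HomogOn U (r - 1) (DY b f) := by
  intro u hu y hy t ht
  have h1 : (fun y' => f u (t • y')) =ᶠ[𝓝 y] fun y' => t ^ r * f u y' := by
    filter_upwards [isOpen_compl_singleton.mem_nhds hy] with y' hy' using h u hu y' hy' t ht
  have h2 := h1.fderiv_eq (𝕜 := ℝ)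
  have h3 : fderiv ℝ (fun y' => t ^ r * f u y') y = (t ^ r : ℝ) • fderiv ℝ (f u) y := by
    change fderiv ℝ ((t ^ r : ℝ) • f u) y = _
    rw [fderiv_const_smul_field]
    rfl
  have h4 : fderiv ℝ (fun y' => f u (t • y')) y = t • fderiv ℝ (f u) (t • y) :=
    fderiv_comp_smul t
  rw [h3, h4] at h2
  have h5 := congrArg (fun L : Eu n →L[ℝ] ℝ => L b) h2
  simp only [smul_apply, smul_eq_mul] at h5
  unfold Randers.DY
  rw [zpow_sub_one₀ ht.ne']
  field_simp
  linarith

theorem SmoothOn.mul (hf : SmoothOn U f) (hg : SmoothOn U g) :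
    SmoothOn U (fun u y => f u y * g u y) := ContDiffOn.mul hf hg

theorem SmoothOn.add (hf : SmoothOn U f) (hg : SmoothOn U g) :
    SmoothOn U (fun u y => f u y + g u y) := ContDiffOn.add hf hg

theorem SmoothOn.sub (hf : SmoothOn U f) (hg : SmoothOn U g) :
    SmoothOn U (fun u y => f u y - g u y) := ContDiffOn.sub hf hg

theorem SmoothOn.const_mul (c : ℝ) (hf : SmoothOn U f) :
    SmoothOn U (fun u y => c * f u y) := ContDiffOn.mul contDiffOn_const hf

theorem SmoothOn.sum {ι : Type*} {s : Finset ι} {f : ι → Eu n → Eu n → ℝ}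
    (hf : ∀ i ∈ s, SmoothOn U (f i)) : SmoothOn U (fun u y => ∑ i ∈ s, f i u y) :=
  ContDiffOn.sum hf

theorem SmoothOn.prod {ι : Type*} {s : Finset ι} {f : ι → Eu n → Eu n → ℝ}
    (hf : ∀ i ∈ s, SmoothOn U (f i)) : SmoothOn U (fun u y => ∏ i ∈ s, f i u y) :=
  contDiffOn_prod hf

theorem smoothOn_coord (k : Fin n) : SmoothOn U (fun _ y => y k) :=
  ((EuclideanSpace.proj (𝕜 := ℝ) k).contDiff.comp contDiff_snd).contDiffOn

theorem smoothOn_const (c : ℝ) : SmoothOn U (fun _ _ => c) := contDiffOn_const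

theorem SmoothOn.of_fst {f : Eu n → ℝ} (hf : ContDiffOn ℝ ∞ f U) : SmoothOn U (fun u _ => f u) :=
  hf.comp contDiffOn_fst fun _ hz => hz.1

theorem DZ_mul (hf : SmoothOn U f) (hg : SmoothOn U g) (hU : IsOpen U) (hu : u ∈ U) (hy : y ≠ 0)
    (a b : Eu n) : DZ a b (fun u y => f u y * g u y) u y
      = DZ a b f u y * g u y + f u y * DZ a b g u y := by
  refine (hf.mul hg).DZ_eq hU hu hy ?_
  have h := (hf.hasDerivAt_line hU hu hy a b).fun_mul (hg.hasDerivAt_line hU hu hy a b)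
  simp only [zero_smul, add_zero] at h
  exact h

theorem DZ_const_mul (c : ℝ) (hf : SmoothOn U f) (hU : IsOpen U) (hu : u ∈ U) (hy : y ≠ 0)
    (a b : Eu n) : DZ a b (fun u y => c * f u y) u y = c * DZ a b f u y :=
  (hf.const_mul c).DZ_eq hU hu hy ((hf.hasDerivAt_line hU hu hy a b).const_mul c)

theorem DZ_sum {ι : Type*} {s : Finset ι} {f : ι → Eu n → Eu n → ℝ}
    (hf : ∀ i ∈ s, SmoothOn U (f i)) (hU : IsOpen U) (hu : u ∈ U) (hy : y ≠ 0) (a b : Eu n) :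
    DZ a b (fun u y => ∑ i ∈ s, f i u y) u y = ∑ i ∈ s, DZ a b (f i) u y :=
  (SmoothOn.sum hf).DZ_eq hU hu hy
    (HasDerivAt.fun_sum fun i hi => (hf i hi).hasDerivAt_line hU hu hy a b)

theorem hasDerivAt_eu {κ : ℝ → Eu n} {k : Eu n} {t : ℝ}
    (h : ∀ i, HasDerivAt (fun s => κ s i) (k i) t) : HasDerivAt κ k t := by
  have h1 : HasDerivAt (fun s => ∑ i, κ s i • (e i : Eu n)) (∑ i, k i • (e i : Eu n)) t :=
    HasDerivAt.fun_sum fun i _ => (h i).smul_const _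
  simpa only [sum_smul_e] using h1

/-- Jacobi's formula. The product rule in the Leibniz expansion replaces one column at a time by its
derivative, and Cramer's rule recognizes these determinants as the diagonal of `adj(M) M'`. -/
theorem hasDerivAt_det {M : ℝ → Matrix (Fin n) (Fin n) ℝ} {M' : Matrix (Fin n) (Fin n) ℝ} {t : ℝ}
    (h : ∀ i j, HasDerivAt (fun s => M s i j) (M' i j) t) :
    HasDerivAt (fun s => (M s).det) ((M t).adjugate * M').trace t := by
  have h1 : HasDerivAt (fun s => ∑ σ : Equiv.Perm (Fin n),
      ((Equiv.Perm.sign σ : ℤ) : ℝ) * ∏ i, M s (σ i) i) _ t :=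
    HasDerivAt.fun_sum fun σ _ => (HasDerivAt.fun_finsetProd fun i _ => h (σ i) i).const_mul _
  simp only [Matrix.det_apply']
  convert h1 using 1
  have h2 : ((M t).adjugate * M').trace = ∑ i, ((M t).updateCol i (fun k => M' k i)).det := by
    refine Finset.sum_congr rfl fun i _ => ?_
    rw [Matrix.diag_apply, ← Matrix.cramer_apply, Matrix.cramer_eq_adjugate_mulVec]
    rfl
  rw [h2]
  simp only [Matrix.det_apply', Finset.mul_sum]
  rw [Finset.sum_comm]
  refine Finset.sum_congr rfl fun σ _ => Finset.sum_congr rfl fun i _ => ?_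
  rw [← Finset.mul_prod_erase Finset.univ _ (Finset.mem_univ i), Matrix.updateCol_self, smul_eq_mul,
    mul_comm (∏ j ∈ Finset.univ.erase i, _)]
  congr 2
  exact Finset.prod_congr rfl fun j hj => Matrix.updateCol_ne (Finset.ne_of_mem_erase hj)

end Calculus

end Randers
end

noncomputable section
namespace Randers

/-! ### Spray, Chern connection and S-curvature of a local Finsler metric -/

/-- `F` is smooth, positive and positively homogeneous on `U × (ℝⁿ ∖ 0)`. -/
structure IsPosHomogOn {n : ℕ} (U : Set (Eu n)) (F : Eu n → Eu n → ℝ) : Prop where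
  isOpen : IsOpen U
  smooth : SmoothOn U F
  homog : HomogOn U 1 F
  pos : ∀ u ∈ U, ∀ y ≠ 0, 0 < F u y

/-- `F` is smooth, positive, positively homogeneous and nondegenerate on `U × (ℝⁿ ∖ 0)`. -/
structure IsFinslerOn {n : ℕ} (U : Set (Eu n)) (F : Eu n → Eu n → ℝ) : Prop
    extends IsPosHomogOn U F where
  det_ne_zero : ∀ u ∈ U, ∀ y ≠ 0, (fundForm F u y).det ≠ 0

/-- The vector of geodesic coefficients. -/
def geodVec {n : ℕ} (F : Eu n → Eu n → ℝ) (u y : Eu n) : Eu n :=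
  WithLp.toLp 2 fun i => geodCoeff F i u y

/-- The vector `Nⁱⱼ Xʲ`. -/
def nonlinVec {n : ℕ} (F : Eu n → Eu n → ℝ) (X u y : Eu n) : Eu n :=
  WithLp.toLp 2 fun i => DY X (geodCoeff F i) u y

/-- The vector `Γⁱⱼₖ Xʲ Yᵏ`. -/
def conVec {n : ℕ} (Γ : Fin n → Fin n → Fin n → ℝ) (X Y : Eu n) : Eu n :=
  WithLp.toLp 2 fun i => ∑ j, ∑ k, Γ i j k * X j * Y k

/-- The derivative along the geodesic spray. -/
def spray {n : ℕ} (F : Eu n → Eu n → ℝ) (f : Eu n → Eu n → ℝ) (u y : Eu n) : ℝ :=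
  DZ y ((-2 : ℝ) • geodVec F u y) f u y

/-- The bilinear form of a matrix. -/
def bil {n : ℕ} (M : Matrix (Fin n) (Fin n) ℝ) (Z Y : Eu n) : ℝ :=
  ∑ i, ∑ j, M i j * Z i * Y j

section

variable {n : ℕ} {U : Set (Eu n)} {F : Eu n → Eu n → ℝ} {u y : Eu n}

/-- Lowering an index. The geodesic coefficients and both connections are defined by applying an
inverse matrix; pairing them with a vector through the matrix removes the inverse. -/
theorem bil_solve {M : Matrix (Fin n) (Fin n) ℝ} (hM : M.det ≠ 0) (hs : M.transpose = M)
    (b : Fin n → ℝ) {Z : Eu n} {c : ℝ} (hZ : ∀ i, Z i = c * ∑ l, M⁻¹ i l * b l) (Y : Eu n) :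
    bil M Z Y = c * ∑ l, b l * Y l := by
  have hu : IsUnit M.det := isUnit_iff_ne_zero.2 hM
  have h1 : ∀ j, ∑ i, M i j * Z i = c * b j := by
    intro j
    have h2 : M.mulVec (M⁻¹.mulVec b) j = b j := by
      rw [Matrix.mulVec_mulVec, Matrix.mul_nonsing_inv _ hu, Matrix.one_mulVec]
    rw [← h2, Matrix.mulVec, dotProduct, Finset.mul_sum]
    refine Finset.sum_congr rfl fun i _ => ?_
    rw [hZ i, show M i j = M j i from congrFun (congrFun hs j) i]
    simp only [Matrix.mulVec, dotProduct]
    ring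
  unfold bil
  rw [Finset.sum_comm, Finset.mul_sum]
  refine Finset.sum_congr rfl fun j _ => ?_
  rw [← Finset.sum_mul, h1, mul_assoc]

theorem sum_christoffel (D : Fin n → Fin n → Fin n → ℝ) (X y Y : Eu n) :
    ∑ l, (∑ j, ∑ k, (D j l k + D k j l - D l j k) * X j * y k) * Y l
      = (∑ l, ∑ k, ∑ j, D j l k * Y l * y k * X j) + (∑ j, ∑ l, ∑ k, D k j l * X j * Y l * y k)
        - ∑ j, ∑ k, ∑ l, D l j k * X j * y k * Y l := by
  simp only [add_mul, sub_mul, Finset.sum_add_distrib, Finset.sum_sub_distrib, Finset.sum_mul]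
  congr 1
  · congr 1
    · refine Finset.sum_congr rfl fun l _ => ?_
      rw [Finset.sum_comm]
      exact Finset.sum_congr rfl fun k _ => Finset.sum_congr rfl fun j _ => by ring
    · rw [Finset.sum_comm]
      exact Finset.sum_congr rfl fun j _ => Finset.sum_congr rfl fun l _ =>
        Finset.sum_congr rfl fun k _ => by ring
  · rw [Finset.sum_comm]
    refine Finset.sum_congr rfl fun j _ => ?_
    rw [Finset.sum_comm]

/-- Moves the inverse metric outside the contraction with `X` and `y`, into the shape required by
`bil_solve`. -/
theorem sum_christoffel_left (a : Fin n → ℝ) (D : Fin n → Fin n → Fin n → ℝ) (X y : Eu n) :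
    ∑ j, ∑ k, 1 / 2 * (∑ l, a l * (D j l k + D k j l - D l j k)) * X j * y k
      = 1 / 2 * ∑ l, a l * ∑ j, ∑ k, (D j l k + D k j l - D l j k) * X j * y k := by
  simp only [Finset.mul_sum, Finset.sum_mul]
  have : ∀ j : Fin n, ∑ k : Fin n, ∑ l : Fin n, 1 / 2 * (a l * (D j l k + D k j l - D l j k))
      * X j * y k
      = ∑ l : Fin n, ∑ k : Fin n, 1 / 2 * (a l * ((D j l k + D k j l - D l j k) * X j * y k)) := by
    intro j
    rw [Finset.sum_comm]
    exact Finset.sum_congr rfl fun l _ => Finset.sum_congr rfl fun k _ => by ring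
  simp only [this]
  rw [Finset.sum_comm]

theorem SmoothOn.det {M : Fin n → Fin n → Eu n → Eu n → ℝ} (h : ∀ i j, SmoothOn U (M i j)) :
    SmoothOn U (fun u y => (Matrix.of fun i j => M i j u y).det) := by
  simp only [Matrix.det_apply']
  exact SmoothOn.sum fun σ _ => SmoothOn.const_mul _ (SmoothOn.prod fun i _ => h (σ i) i)

theorem SmoothOn.inv {f : Eu n → Eu n → ℝ} (h : SmoothOn U f) (h0 : ∀ u ∈ U, ∀ y ≠ 0, f u y ≠ 0) :
    SmoothOn U (fun u y => (f u y)⁻¹) :=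
  ContDiffOn.inv h fun z hz => h0 z.1 hz.1 z.2 hz.2

/-- The inverse is the adjugate divided by the determinant, and each adjugate entry is the
determinant of the matrix with one row replaced by a constant one. -/
theorem SmoothOn.nonsing_inv {M : Fin n → Fin n → Eu n → Eu n → ℝ} (h : ∀ i j, SmoothOn U (M i j))
    (h0 : ∀ u ∈ U, ∀ y ≠ 0, (Matrix.of fun i j => M i j u y).det ≠ 0) (i l : Fin n) :
    SmoothOn U (fun u y => (Matrix.of fun i j => M i j u y)⁻¹ i l) := by
  have h1 : SmoothOn U (fun u y => (Matrix.of fun i j => M i j u y).adjugate i l) := by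
    simp only [Matrix.adjugate_apply]
    have h2 : ∀ u y, ((Matrix.of fun i j => M i j u y).updateRow l (Pi.single i 1))
        = Matrix.of fun a b => if a = l then (Pi.single i (1 : ℝ) : Fin n → ℝ) b else M a b u y := by
      intro u y
      ext a b
      simp [Matrix.updateRow_apply]
    simp only [h2]
    refine SmoothOn.det fun a b => ?_
    by_cases hab : a = l
    · simp only [hab, if_true]
      exact smoothOn_const _
    · simp only [hab, if_false]
      exact h a b
  refine (((SmoothOn.det h).inv h0).mul h1).congr fun u hu y hy => ?_
  simp [Matrix.inv_def]

theorem HomogOn.sqF (h : HomogOn U 1 F) : HomogOn U 2 (sqF F) := by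
  intro u hu y hy t ht
  simp only [Randers.sqF, h u hu y hy t ht]
  norm_cast
  ring

namespace IsPosHomogOn

theorem smooth_sqF (h : IsPosHomogOn U F) : SmoothOn U (sqF F) :=
  (h.smooth.mul h.smooth).congr fun u _ y _ => sq (F u y)

theorem smooth_fundForm (h : IsPosHomogOn U F) (i j : Fin n) :
    SmoothOn U (fun u y => fundForm F u y i j) :=
  SmoothOn.const_mul (1 / 2) ((h.smooth_sqF.DY h.isOpen (e j)).DY h.isOpen (e i))

theorem fundForm_transpose (h : IsPosHomogOn U F) (hu : u ∈ U) (hy : y ≠ 0) :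
    (fundForm F u y).transpose = fundForm F u y := by
  ext i j
  change (1 / 2) * DY (e j) (DY (e i) (sqF F)) u y = (1 / 2) * DY (e i) (DY (e j) (sqF F)) u y
  rw [h.smooth_sqF.DY_DY h.isOpen hu hy]

theorem bil_fundForm (h : IsPosHomogOn U F) (hu : u ∈ U) (hy : y ≠ 0) (Z Y : Eu n) :
    bil (fundForm F u y) Z Y = 1 / 2 * DY Z (DY Y (sqF F)) u y := by
  rw [← DY_sum Z, Finset.mul_sum]
  refine Finset.sum_congr rfl fun i _ => ?_
  have h1 : dy i (DY Y (sqF F)) u y = ∑ j, Y j * dy i (dy j (sqF F)) u y := by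
    have h2 := h.smooth_sqF.DX_DY_sum h.isOpen hu hy 0 (e i) Y
    simp only [DX_zero, zero_add] at h2
    exact h2.symm
  rw [h1, Finset.mul_sum, Finset.mul_sum]
  refine Finset.sum_congr rfl fun j _ => ?_
  simp only [fundForm, Matrix.of_apply]
  ring

theorem DZ_sqF (h : IsPosHomogOn U F) (hu : u ∈ U) (hy : y ≠ 0) (a b : Eu n) :
    DZ a b (sqF F) u y = 2 * F u y * DZ a b F u y := by
  have h1 := DZ_mul h.smooth h.smooth h.isOpen hu hy a b
  rw [show sqF F = fun u y => F u y * F u y from funext fun u => funext fun y => sq (F u y), h1]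
  ring

theorem DX_sqF (h : IsPosHomogOn U F) (hu : u ∈ U) (hy : y ≠ 0) (a : Eu n) :
    DX a (sqF F) u y = 2 * F u y * DX a F u y := by
  simpa [DZ_zero_right] using h.DZ_sqF hu hy a 0

theorem DY_sqF (h : IsPosHomogOn U F) (hu : u ∈ U) (hy : y ≠ 0) (b : Eu n) :
    DY b (sqF F) u y = 2 * F u y * DY b F u y := by
  simpa [DZ_zero_left] using h.DZ_sqF hu hy 0 b

theorem DZ_DY_sqF (h : IsPosHomogOn U F) (hu : u ∈ U) (hy : y ≠ 0) (a b Y : Eu n) :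
    DZ a b (DY Y (sqF F)) u y
      = 2 * (DZ a b F u y * DY Y F u y + F u y * DZ a b (DY Y F) u y) := by
  rw [← DZ_mul h.smooth (h.smooth.DY h.isOpen Y) h.isOpen hu hy,
    ← DZ_const_mul 2 (h.smooth.mul (h.smooth.DY h.isOpen Y)) h.isOpen hu hy]
  refine DZ_congr h.isOpen (fun u hu y hy => ?_) hu hy a b
  rw [h.DY_sqF hu hy, mul_assoc]

end IsPosHomogOn

namespace IsFinslerOn

theorem geodCoeff_eq (F : Eu n → Eu n → ℝ) (i : Fin n) (u y : Eu n) :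
    geodCoeff F i u y = (1 / 4) * ∑ l, (fundForm F u y)⁻¹ i l *
      (DX y (DY (e l) (sqF F)) u y - DX (e l) (sqF F) u y) := by
  unfold geodCoeff
  congr 1
  refine Finset.sum_congr rfl fun l _ => ?_
  have h1 : ∑ k, dx k (dy l (sqF F)) u y * y k = DX y (DY (e l) (sqF F)) u y := by
    rw [← DX_sum y]
    exact Finset.sum_congr rfl fun k _ => mul_comm _ _
  rw [h1]
  rfl

theorem smooth_geodCoeff (h : IsFinslerOn U F) (i : Fin n) : SmoothOn U (geodCoeff F i) := by
  have hd : ∀ l, SmoothOn U (dy l (sqF F)) := fun l => h.smooth_sqF.DY h.isOpen (e l)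
  have h1 : ∀ l, SmoothOn U (fun u y => ∑ k, dx k (dy l (sqF F)) u y * y k) := fun l =>
    SmoothOn.sum fun k _ => SmoothOn.mul ((hd l).DX h.isOpen (e k)) (smoothOn_coord k)
  have h2 : ∀ l, SmoothOn U (fun u y => (fundForm F u y)⁻¹ i l *
      ((∑ k, dx k (dy l (sqF F)) u y * y k) - dx l (sqF F) u y)) := fun l =>
    SmoothOn.mul ?_ ((h1 l).sub (h.smooth_sqF.DX h.isOpen (e l)))
  · exact SmoothOn.const_mul _ (SmoothOn.sum fun l _ => h2 l)
  exact SmoothOn.nonsing_inv (M := fun i j u y => fundForm F u y i j) h.smooth_fundForm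
    h.det_ne_zero i l

theorem homog_geodCoeff (h : IsFinslerOn U F) (i : Fin n) : HomogOn U 2 (geodCoeff F i) := by
  intro u hu y hy t ht
  have hg : fundForm F u (t • y) = fundForm F u y := by
    ext i j
    have := (h.homog.sqF.DY (e j)).DY (e i) u hu y hy t ht
    simp only [fundForm, Matrix.of_apply]
    change _ * DY (e i) (DY (e j) (sqF F)) u (t • y) = _ * DY (e i) (DY (e j) (sqF F)) u y
    rw [this]
    norm_num
  rw [geodCoeff_eq, geodCoeff_eq, hg, Finset.mul_sum, Finset.mul_sum, Finset.mul_sum]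
  refine Finset.sum_congr rfl fun l _ => ?_
  rw [DX_smul, ((h.homog.sqF.DY (e l)).DX h.isOpen y) u hu y hy t ht,
    (h.homog.sqF.DX h.isOpen (e l)) u hu y hy t ht, zpow_sub_one₀ ht.ne']
  field_simp

/-- The definition of the geodesic coefficients with its index lowered; every later property of the
spray is drawn from this identity. -/
theorem two_mul_DY_geodVec (h : IsFinslerOn U F) (hu : u ∈ U) (hy : y ≠ 0) (Y : Eu n) :
    2 * DY (geodVec F u y) (DY Y (sqF F)) u y
      = DX y (DY Y (sqF F)) u y - DX Y (sqF F) u y := by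
  have h1 := bil_solve (h.det_ne_zero u hu y hy) (h.fundForm_transpose hu hy)
    (fun l => DX y (DY (e l) (sqF F)) u y - DX (e l) (sqF F) u y) (Z := geodVec F u y)
    (c := 1 / 4) (fun i => geodCoeff_eq F i u y) Y
  rw [h.bil_fundForm hu hy] at h1
  have h2 : ∑ l, (DX y (DY (e l) (sqF F)) u y - DX (e l) (sqF F) u y) * Y l
      = DX y (DY Y (sqF F)) u y - DX Y (sqF F) u y := by
    simp only [sub_mul, Finset.sum_sub_distrib]
    rw [← DX_sum Y]
    congr 1
    · have h3 := h.smooth_sqF.DX_DY_sum h.isOpen hu hy y 0 Y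
      simp only [DY_zero, add_zero] at h3
      rw [← h3]
      exact Finset.sum_congr rfl fun k _ => mul_comm _ _
    · exact Finset.sum_congr rfl fun k _ => mul_comm _ _
  rw [h2] at h1
  linarith

theorem spray_apply (F f : Eu n → Eu n → ℝ) (u y : Eu n) :
    spray F f u y = DX y f u y - 2 * DY (geodVec F u y) f u y := by
  simp only [spray, DZ, DY_smul]
  ring

/-- The Euler-Lagrange equation of the energy `F²`. -/
theorem spray_DY_sqF (h : IsFinslerOn U F) (hu : u ∈ U) (hy : y ≠ 0) (Y : Eu n) :
    spray F (DY Y (sqF F)) u y = DX Y (sqF F) u y := by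
  rw [spray_apply, h.two_mul_DY_geodVec hu hy]
  ring

/-- Conservation of energy: take `Y = y` in the Euler-Lagrange equation and apply Euler's theorem in
degrees two and one. -/
theorem spray_sqF (h : IsFinslerOn U F) (hu : u ∈ U) (hy : y ≠ 0) : spray F (sqF F) u y = 0 := by
  have h1 := h.spray_DY_sqF hu hy y
  rw [spray_apply, h.smooth_sqF.DX_DY h.isOpen hu hy, h.smooth_sqF.DY_DY h.isOpen hu hy,
    (h.homog.sqF.DX h.isOpen y).euler (h.smooth_sqF.DX h.isOpen y) h.isOpen hu hy,
    (h.homog.sqF.DY _).euler (h.smooth_sqF.DY h.isOpen _) h.isOpen hu hy] at h1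
  rw [spray_apply]
  push_cast at h1
  linarith

theorem spray_self (h : IsFinslerOn U F) (hu : u ∈ U) (hy : y ≠ 0) : spray F F u y = 0 := by
  have h1 := h.spray_sqF hu hy
  rw [spray, h.DZ_sqF hu hy] at h1
  have := h.pos u hu y hy
  rw [spray]
  simpa [this.ne'] using h1

/-- Since `F` is constant along the spray, the factor `2F` can be divided out of the Euler-Lagrange
equation of `F²`. -/
theorem spray_DY (h : IsFinslerOn U F) (hu : u ∈ U) (hy : y ≠ 0) (Y : Eu n) :
    spray F (DY Y F) u y = DX Y F u y := by
  have h1 := h.spray_DY_sqF hu hy Y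
  have h0 := h.spray_self hu hy
  rw [spray] at h0
  rw [spray, h.DZ_DY_sqF hu hy, h0, h.DX_sqF hu hy] at h1
  have := h.pos u hu y hy
  rw [spray]
  have h2 : F u y * (DZ y ((-2 : ℝ) • geodVec F u y) (DY Y F) u y) = F u y * DX Y F u y := by
    linarith
  exact mul_left_cancel₀ this.ne' h2

/-- Obtained by differentiating `two_mul_DY_geodVec` in the direction variable along `y + s • X`. -/
theorem two_mul_DY_nonlinVec (h : IsFinslerOn U F) (hu : u ∈ U) (hy : y ≠ 0) (X Y : Eu n) :
    2 * DY (nonlinVec F X u y) (DY Y (sqF F)) u y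
      = DX X (DY Y (sqF F)) u y - DX Y (DY X (sqF F)) u y
        + spray F (DY X (DY Y (sqF F))) u y := by
  have hU := h.isOpen
  have hQ := h.smooth_sqF
  have hα : HasDerivAt (fun _ : ℝ => u) 0 (0 : ℝ) := hasDerivAt_const _ _
  have hβ := Randers.hasDerivAt_line y X 0
  have hy0 : y + (0 : ℝ) • X ≠ 0 := by simpa using hy
  have hG : HasDerivAt (fun s : ℝ => geodVec F u (y + s • X)) (nonlinVec F X u y) 0 := by
    refine hasDerivAt_eu fun i => ?_
    have := (h.smooth_geodCoeff i).hasDerivAt hU hα hβ hu hy0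
    simp only [DX_zero, zero_smul, add_zero, zero_add] at this
    exact this
  have h1 := ((hQ.DY hU Y).hasDerivAt_DY hU hα hβ hG hu hy0).const_mul 2
  have h2 := ((hQ.DY hU Y).hasDerivAt_DX hU hα hβ hβ hu hy0).fun_sub
    ((hQ.DX hU Y).hasDerivAt hU hα hβ hu hy0)
  have h3 := (h1.congr_of_eventuallyEq (f₁ := fun s : ℝ => DX (y + s • X) (DY Y (sqF F)) u (y + s • X)
      - DX Y (sqF F) u (y + s • X)) ?_).unique h2
  · simp only [zero_smul, add_zero, DX_zero, zero_add] at h3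
    rw [spray_apply, hQ.DX_DY hU hu hy Y X]
    rw [(hQ.DY hU Y).DY_DY hU hu hy X, ← (hQ.DY hU Y).DX_DY hU hu hy] at h3
    linarith
  · have hc : ContinuousAt (fun s : ℝ => y + s • X) 0 := hβ.continuousAt
    filter_upwards [hc.eventually_ne hy0] with s hs
    rw [h.two_mul_DY_geodVec hu hs]

theorem nonlinVec_self (h : IsFinslerOn U F) (hu : u ∈ U) (hy : y ≠ 0) :
    nonlinVec F y u y = (2 : ℝ) • geodVec F u y := by
  ext i
  have := (h.homog_geodCoeff i).euler (h.smooth_geodCoeff i) h.isOpen hu hy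
  simpa [nonlinVec, geodVec] using this

/-- The inner direction `y` is frozen, so it can be commuted outward and Euler's theorem applied in
degree `r` for the position derivative and `r - 1` for the vertical one. For `r = 1` the vertical
term disappears. -/
theorem DZ_DY_self {f : Eu n → Eu n → ℝ} {r : ℤ} (hf : SmoothOn U f) (hr : HomogOn U r f)
    (hU : IsOpen U) (hu : u ∈ U) (hy : y ≠ 0) (a b : Eu n) :
    DZ a b (DY y f) u y = r * DX a f u y + (r - 1) * DY b f u y := by
  rw [DZ, hf.DX_DY hU hu hy, hf.DY_DY hU hu hy, (hr.DX hU a).euler (hf.DX hU a) hU hu hy,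
    (hr.DY b).euler (hf.DY hU b) hU hu hy]
  push_cast
  ring

theorem horizDeriv_eq (F f : Eu n → Eu n → ℝ) (j : Fin n) (u y : Eu n) :
    horizDeriv F j f u y = DZ (e j) (-nonlinVec F (e j) u y) f u y := by
  have : DY (-nonlinVec F (e j) u y) f u y = - DY (nonlinVec F (e j) u y) f u y := by simp [DY]
  rw [DZ, this, ← DY_sum (nonlinVec F (e j) u y), ← sub_eq_add_neg]
  rfl

theorem nonlinVec_sum (X u y : Eu n) :
    ∑ j, X j • nonlinVec F (e j) u y = nonlinVec F X u y := by
  ext i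
  rw [WithLp.ofLp_sum, Finset.sum_apply]
  simp only [nonlinVec, PiLp.smul_apply, smul_eq_mul]
  exact DY_sum X (geodCoeff F i) u y

theorem sum_horizDeriv (F f : Eu n → Eu n → ℝ) (X u y : Eu n) :
    ∑ j, X j * horizDeriv F j f u y = DZ X (-nonlinVec F X u y) f u y := by
  simp only [horizDeriv_eq, DZ, mul_add, Finset.sum_add_distrib]
  congr 1
  · exact DX_sum X f u y
  · rw [← nonlinVec_sum X, ← Finset.sum_neg_distrib]
    simp only [DY, map_sum, ← smul_neg, map_smul, smul_eq_mul]

theorem sum_horizDeriv_fundForm (h : IsFinslerOn U F) (hu : u ∈ U) (hy : y ≠ 0) (X Z Y : Eu n) :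
    ∑ i, ∑ j, ∑ k, horizDeriv F k (fun u y => fundForm F u y i j) u y * Z i * Y j * X k
      = 1 / 2 * DZ X (-nonlinVec F X u y) (DY Z (DY Y (sqF F))) u y := by
  rw [← DZ_const_mul _ ((h.smooth_sqF.DY h.isOpen Y).DY h.isOpen Z) h.isOpen hu hy,
    ← DZ_congr h.isOpen (fun u hu y hy => h.bil_fundForm hu hy Z Y) hu hy]
  have hs : ∀ i j, SmoothOn U (fun u y => fundForm F u y i j * Z i * Y j) := fun i j =>
    ((h.smooth_fundForm i j).mul (smoothOn_const _)).mul (smoothOn_const _)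
  unfold bil
  rw [DZ_sum (fun i _ => SmoothOn.sum fun j _ => hs i j) h.isOpen hu hy]
  refine Finset.sum_congr rfl fun i _ => ?_
  rw [DZ_sum (fun j _ => hs i j) h.isOpen hu hy]
  refine Finset.sum_congr rfl fun j _ => ?_
  have h1 := DZ_const_mul (Z i * Y j) (h.smooth_fundForm i j) h.isOpen hu hy X
    (-nonlinVec F X u y)
  rw [show (fun u y => fundForm F u y i j * Z i * Y j) = fun u y => Z i * Y j * fundForm F u y i j
    from funext fun u => funext fun y => by ring, h1, ← sum_horizDeriv, Finset.mul_sum]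
  exact Finset.sum_congr rfl fun k _ => by ring

/-- The Chern connection, contracted with the reference vector. -/
theorem bil_chern (h : IsFinslerOn U F) (hu : u ∈ U) (hy : y ≠ 0) (X Y : Eu n) :
    bil (fundForm F u y) (conVec (chern F u y) X y) Y
      = 1 / 4 * (DX X (DY Y (sqF F)) u y - DX Y (DY X (sqF F)) u y
        + spray F (DY X (DY Y (sqF F))) u y) := by
  have hU := h.isOpen
  have hQ := h.smooth_sqF
  have h1 := bil_solve (h.det_ne_zero u hu y hy) (h.fundForm_transpose hu hy)
    (fun l => ∑ j, ∑ k, (horizDeriv F j (fun u y => fundForm F u y l k) u y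
      + horizDeriv F k (fun u y => fundForm F u y j l) u y
      - horizDeriv F l (fun u y => fundForm F u y j k) u y) * X j * y k)
    (Z := conVec (chern F u y) X y) (c := 1 / 2) (fun i => ?_) Y
  · rw [h1]
    -- In the first and third Christoffel terms the reference vector fills a slot of `g`; there
    -- `DZ_DY_self` with `r = 1` eliminates the nonlinear connection. In the second term it is the
    -- direction of the horizontal derivative, and `N(y) = 2G` turns that derivative into the spray.
    have e1 := h.sum_horizDeriv_fundForm hu hy X Y y
    have e2 := h.sum_horizDeriv_fundForm hu hy y X Y
    have e3 := h.sum_horizDeriv_fundForm hu hy Y X y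
    rw [DZ_congr hU (fun u hu z hz => hQ.DY_DY hU hu hz Y y) hu hy,
      DZ_DY_self (hQ.DY hU Y) (h.homog.sqF.DY Y) hU hu hy] at e1
    rw [DZ_congr hU (fun u hu z hz => hQ.DY_DY hU hu hz X y) hu hy,
      DZ_DY_self (hQ.DY hU X) (h.homog.sqF.DY X) hU hu hy] at e3
    rw [h.nonlinVec_self hu hy, ← neg_smul] at e2
    change _ = 1 / 2 * spray F _ u y at e2
    have e4 := sum_christoffel (fun k i j => horizDeriv F k (fun u y => fundForm F u y i j) u y) X y Y
    rw [e4, e1, e2, e3]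
    push_cast
    ring
  · exact sum_christoffel_left (fun l => (fundForm F u y)⁻¹ i l)
      (fun k i j => horizDeriv F k (fun u y => fundForm F u y i j) u y) X y

theorem trace_skew {A M : Matrix (Fin n) (Fin n) ℝ} (hA : A.transpose = A) :
    (A * (M - M.transpose)).trace = 0 := by
  have h1 : (A * M.transpose).trace = (A * M).trace := by
    rw [← Matrix.trace_transpose, Matrix.transpose_mul, Matrix.transpose_transpose, hA,
      Matrix.trace_mul_comm]
  rw [mul_sub, Matrix.trace_sub, h1, sub_self]

/-- `∂Gⁱ/∂yⁱ` is half the logarithmic derivative of `det g` along the spray. -/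
theorem sum_dy_geodCoeff (h : IsFinslerOn U F) (hu : u ∈ U) (hy : y ≠ 0) :
    ∑ i, dy i (geodCoeff F i) u y
      = 1 / 2 * (spray F (fun u y => (fundForm F u y).det) u y / (fundForm F u y).det) := by
  have hU := h.isOpen
  set g := fundForm F u y with hg
  have hd := h.det_ne_zero u hu y hy
  have hunit : IsUnit g.det := isUnit_iff_ne_zero.2 hd
  set S : Matrix (Fin n) (Fin n) ℝ :=
    Matrix.of fun i j => spray F (fun u y => fundForm F u y i j) u y with hS
  set A : Matrix (Fin n) (Fin n) ℝ :=
    Matrix.of fun l j => 1 / 4 * DX (e j) (DY (e l) (sqF F)) u y with hA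
  set Nm : Matrix (Fin n) (Fin n) ℝ := Matrix.of fun i j => DY (e j) (geodCoeff F i) u y with hN
  -- The nonlinear connection with lowered index is a skew part plus half the spray derivative of
  -- `g`; the trace against the symmetric `g⁻¹` sees only the latter.
  have h1 : g * Nm = (A - A.transpose) + (1 / 2 : ℝ) • S := by
    ext l j
    have h2 := h.bil_fundForm hu hy (nonlinVec F (e j) u y) (e l)
    have h3 := h.two_mul_DY_nonlinVec hu hy (e j) (e l)
    have h4 : bil g (nonlinVec F (e j) u y) (e l) = (g * Nm) l j := by
      rw [Matrix.mul_apply, bil]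
      refine Finset.sum_congr rfl fun i _ => ?_
      rw [Finset.sum_eq_single l]
      · rw [show g i l = g l i from congrFun (congrFun (h.fundForm_transpose hu hy) l) i]
        simp [e, nonlinVec, hN]
      · intro k _ hk
        simp [e, hk]
      · simp
    have h5 : S l j = 1 / 2 * spray F (DY (e j) (DY (e l) (sqF F))) u y := by
      simp only [hS, Matrix.of_apply, spray]
      rw [← DZ_const_mul _ ((h.smooth_sqF.DY hU (e l)).DY hU (e j)) hU hu hy]
      refine DZ_congr hU (fun u hu y hy => ?_) hu hy _ _
      rw [h.smooth_sqF.DY_DY hU hu hy]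
      rfl
    rw [← h4, h2]
    simp only [Matrix.add_apply, Matrix.sub_apply, Matrix.transpose_apply, Matrix.smul_apply, h5,
      hA, Matrix.of_apply, smul_eq_mul]
    linarith
  have h6 : spray F (fun u y => (fundForm F u y).det) u y = (g.adjugate * S).trace := by
    have h7 : SmoothOn U (fun u y => (fundForm F u y).det) :=
      SmoothOn.det (M := fun i j u y => fundForm F u y i j) h.smooth_fundForm
    refine h7.DZ_eq hU hu hy ?_
    have h8 := hasDerivAt_det (M := fun s : ℝ => fundForm F (u + s • y)
      (y + s • ((-2 : ℝ) • geodVec F u y))) (M' := S) (t := 0)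
      (fun i j => (h.smooth_fundForm i j).hasDerivAt_line hU hu hy _ _)
    simp only [zero_smul, add_zero] at h8
    exact h8
  have h9 : Nm = g⁻¹ * ((A - A.transpose) + (1 / 2 : ℝ) • S) := by
    rw [← h1, ← mul_assoc, Matrix.nonsing_inv_mul _ hunit, one_mul]
  have hgi : (g⁻¹).transpose = g⁻¹ := by
    rw [Matrix.transpose_nonsing_inv, h.fundForm_transpose hu hy]
  have h10 : g.adjugate = g.det • g⁻¹ := by
    rw [Matrix.inv_def, smul_smul, Ring.mul_inverse_cancel _ hunit, one_smul]
  have h11 : Nm.trace = 1 / 2 * (g⁻¹ * S).trace := by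
    rw [h9, mul_add, Matrix.trace_add, trace_skew hgi, Matrix.mul_smul, Matrix.trace_smul, zero_add,
      smul_eq_mul]
  change Nm.trace = _
  rw [h11, h6, h10, Matrix.smul_mul, Matrix.trace_smul, smul_eq_mul, mul_div_cancel_left₀ _ hd]

end IsFinslerOn

end

end Randers
end

noncomputable section
namespace Randers

/-! ### Bilinear forms of matrices -/

section Bil

variable {n : ℕ} (M : Matrix (Fin n) (Fin n) ℝ) (X Y Z : Eu n) (c : ℝ)

theorem bil_add_left : bil M (X + Y) Z = bil M X Z + bil M Y Z := by
  simp only [bil, PiLp.add_apply, ← Finset.sum_add_distrib]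
  exact Finset.sum_congr rfl fun i _ => Finset.sum_congr rfl fun j _ => by ring

theorem bil_smul_left : bil M (c • X) Z = c * bil M X Z := by
  simp only [bil, PiLp.smul_apply, smul_eq_mul, Finset.mul_sum]
  exact Finset.sum_congr rfl fun i _ => Finset.sum_congr rfl fun j _ => by ring

theorem bil_add_right : bil M X (Y + Z) = bil M X Y + bil M X Z := by
  simp only [bil, PiLp.add_apply, ← Finset.sum_add_distrib]
  exact Finset.sum_congr rfl fun i _ => Finset.sum_congr rfl fun j _ => by ring

theorem bil_smul_right : bil M X (c • Z) = c * bil M X Z := by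
  simp only [bil, PiLp.smul_apply, smul_eq_mul, Finset.mul_sum]
  exact Finset.sum_congr rfl fun i _ => Finset.sum_congr rfl fun j _ => by ring

theorem bil_neg_left : bil M (-X) Z = -bil M X Z := by
  rw [← neg_one_smul ℝ X, bil_smul_left, neg_one_mul]

theorem bil_neg_right : bil M X (-Z) = -bil M X Z := by
  rw [← neg_one_smul ℝ Z, bil_smul_right, neg_one_mul]

theorem bil_sub_left : bil M (X - Y) Z = bil M X Z - bil M Y Z := by
  rw [sub_eq_add_neg, bil_add_left, bil_neg_left, sub_eq_add_neg]

theorem bil_sub_right : bil M X (Y - Z) = bil M X Y - bil M X Z := by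
  rw [sub_eq_add_neg, bil_add_right, bil_neg_right, sub_eq_add_neg]

theorem bil_zero_left : bil M 0 Z = 0 := by simp [bil]

theorem bil_zero_right : bil M Z 0 = 0 := by simp [bil]

theorem bil_add_matrix (M' : Matrix (Fin n) (Fin n) ℝ) :
    bil (M + M') X Y = bil M X Y + bil M' X Y := by
  simp only [bil, Matrix.add_apply, add_mul, Finset.sum_add_distrib]

theorem bil_zero_matrix : bil 0 X Y = 0 := by simp [bil]

variable {M} in
theorem bil_comm (hM : ∀ i j, M i j = M j i) : bil M X Y = bil M Y X := by
  simp only [bil]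
  rw [Finset.sum_comm]
  exact Finset.sum_congr rfl fun i _ => Finset.sum_congr rfl fun j _ => by rw [hM]; ring

theorem bil_e (i j : Fin n) : bil M (e i) (e j) = M i j := by
  simp [bil, e]

theorem dotProduct_mulVec_eq_bil : (X : Fin n → ℝ) ⬝ᵥ M.mulVec Z = bil M X Z := by
  simp only [dotProduct, Matrix.mulVec, bil, Finset.mul_sum]
  exact Finset.sum_congr rfl fun i _ => Finset.sum_congr rfl fun j _ => by ring

variable {M X Y Z}

theorem hasDerivAt_bil {M : ℝ → Matrix (Fin n) (Fin n) ℝ} {M' : Matrix (Fin n) (Fin n) ℝ}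
    {Z Y : ℝ → Eu n} {Z' Y' : Eu n} {t : ℝ} (hM : ∀ i j, HasDerivAt (fun s => M s i j) (M' i j) t)
    (hZ : HasDerivAt Z Z' t) (hY : HasDerivAt Y Y' t) :
    HasDerivAt (fun s => bil (M s) (Z s) (Y s))
      (bil M' (Z t) (Y t) + bil (M t) Z' (Y t) + bil (M t) (Z t) Y') t := by
  have h : HasDerivAt (fun s => ∑ i, ∑ j, M s i j * Z s i * Y s j) _ t :=
    HasDerivAt.fun_sum fun i _ => HasDerivAt.fun_sum fun j _ =>
      ((hM i j).fun_mul (hasDerivAt_coord hZ i)).fun_mul (hasDerivAt_coord hY j)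
  unfold bil
  convert h using 1
  simp only [← Finset.sum_add_distrib]
  exact Finset.sum_congr rfl fun i _ => Finset.sum_congr rfl fun j _ => by ring

theorem posDef_of_bil (hM : ∀ i j, M i j = M j i) (hp : ∀ Z : Eu n, Z ≠ 0 → 0 < bil M Z Z) :
    M.PosDef := by
  refine Matrix.PosDef.of_dotProduct_mulVec_pos ?_ fun x hx => ?_
  · ext i j
    simp [hM i j]
  · have h1 := hp (WithLp.toLp 2 x) (fun h => hx (by simpa using congrArg WithLp.ofLp h))
    rw [← dotProduct_mulVec_eq_bil] at h1
    simpa using h1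

end Bil

/-! ### The metric of a navigation datum in a chart -/

/-- The derivative of a matrix function. -/
def dmat {n : ℕ} (H : Eu n → Matrix (Fin n) (Fin n) ℝ) (u a : Eu n) : Matrix (Fin n) (Fin n) ℝ :=
  Matrix.of fun i j => fderiv ℝ (fun u' => H u' i j) u a

/-- `λ = 1 - h(w, w)`. -/
def navLam {n : ℕ} (H : Eu n → Matrix (Fin n) (Fin n) ℝ) (w : Eu n → Eu n) (u : Eu n) : ℝ :=
  1 - bil (H u) (w u) (w u)

/-- The metric with navigation datum `(h, w)`. -/
def navF {n : ℕ} (H : Eu n → Matrix (Fin n) (Fin n) ℝ) (w : Eu n → Eu n) (u y : Eu n) : ℝ :=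
  (Real.sqrt (navLam H w u * bil (H u) y y + bil (H u) (w u) y ^ 2) - bil (H u) (w u) y)
    / navLam H w u

/-- The vector `v = y - F(y) w`, with `h(v, v) = F(y)²`. -/
def navV {n : ℕ} (H : Eu n → Matrix (Fin n) (Fin n) ℝ) (w : Eu n → Eu n) (u y : Eu n) : Eu n :=
  y - navF H w u y • w u

/-- The denominator `F + h(v, w)`. -/
def navRho {n : ℕ} (H : Eu n → Matrix (Fin n) (Fin n) ℝ) (w : Eu n → Eu n) (u y : Eu n) : ℝ :=
  navF H w u y + bil (H u) (navV H w u y) (w u)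

/-- A smooth Riemannian metric `h` and a smooth vector field `w` on `U` with `h(w, w) < 1`. -/
structure IsNavOn {n : ℕ} (U : Set (Eu n)) (H : Eu n → Matrix (Fin n) (Fin n) ℝ)
    (w : Eu n → Eu n) : Prop where
  isOpen : IsOpen U
  smooth_H : ∀ i j, ContDiffOn ℝ ∞ (fun u => H u i j) U
  smooth_w : ContDiffOn ℝ ∞ w U
  symm : ∀ u ∈ U, ∀ i j, H u i j = H u j i
  pos : ∀ u ∈ U, ∀ y : Eu n, y ≠ 0 → 0 < bil (H u) y y
  lt_one : ∀ u ∈ U, bil (H u) (w u) (w u) < 1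

namespace IsNavOn

variable {n : ℕ} {U : Set (Eu n)} {H : Eu n → Matrix (Fin n) (Fin n) ℝ} {w : Eu n → Eu n}
  {u y : Eu n}

theorem lam_pos (h : IsNavOn U H w) (hu : u ∈ U) : 0 < navLam H w u := by
  have := h.lt_one u hu
  simp only [navLam]
  linarith

theorem comm (h : IsNavOn U H w) (hu : u ∈ U) (X Y : Eu n) : bil (H u) X Y = bil (H u) Y X :=
  bil_comm X Y (h.symm u hu)

theorem dmat_symm (h : IsNavOn U H w) (hu : u ∈ U) (a : Eu n) (i j : Fin n) :
    dmat H u a i j = dmat H u a j i := by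
  simp only [dmat, Matrix.of_apply]
  rw [Filter.EventuallyEq.fderiv_eq]
  filter_upwards [h.isOpen.mem_nhds hu] with u' hu' using h.symm u' hu' i j

theorem dmat_comm (h : IsNavOn U H w) (hu : u ∈ U) (a X Y : Eu n) :
    bil (dmat H u a) X Y = bil (dmat H u a) Y X :=
  bil_comm X Y (h.dmat_symm hu a)

theorem bil_nonneg (h : IsNavOn U H w) (hu : u ∈ U) (Z : Eu n) : 0 ≤ bil (H u) Z Z := by
  by_cases hZ : Z = 0
  · simp [hZ, bil_zero_left]
  · exact (h.pos u hu Z hZ).le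

/-- The square root equals `λF + h(w, y)` by definition of `F`; inserting `y = v + F w` gives `F +
h(v, w)`. In particular the denominator `ρ` is positive. -/
theorem sqrt_eq (h : IsNavOn U H w) (hu : u ∈ U) (y : Eu n) :
    Real.sqrt (navLam H w u * bil (H u) y y + bil (H u) (w u) y ^ 2) = navRho H w u y := by
  have hl := h.lam_pos hu
  have h1 : navLam H w u * navF H w u y + bil (H u) (w u) y
      = Real.sqrt (navLam H w u * bil (H u) y y + bil (H u) (w u) y ^ 2) := by
    rw [navF, mul_div_cancel₀ _ hl.ne']
    ring
  rw [← h1, navRho, navV, bil_sub_left, bil_smul_left, h.comm hu y]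
  simp only [navLam]
  ring

theorem radicand_pos (h : IsNavOn U H w) (hu : u ∈ U) (hy : y ≠ 0) :
    0 < navLam H w u * bil (H u) y y + bil (H u) (w u) y ^ 2 :=
  add_pos_of_pos_of_nonneg (mul_pos (h.lam_pos hu) (h.pos u hu y hy)) (sq_nonneg _)

theorem rho_pos (h : IsNavOn U H w) (hu : u ∈ U) (hy : y ≠ 0) : 0 < navRho H w u y := by
  rw [← h.sqrt_eq hu]
  exact Real.sqrt_pos.2 (h.radicand_pos hu hy)

theorem F_pos (h : IsNavOn U H w) (hu : u ∈ U) (hy : y ≠ 0) : 0 < navF H w u y := by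
  have hl := h.lam_pos hu
  refine div_pos (sub_pos.2 (lt_of_le_of_lt (le_abs_self _) ?_)) hl
  rw [← Real.sqrt_sq_eq_abs]
  exact Real.sqrt_lt_sqrt (sq_nonneg _) (lt_add_of_pos_left _ (mul_pos hl (h.pos u hu y hy)))

/-- The defining equation of the metric. -/
theorem bil_navV (h : IsNavOn U H w) (hu : u ∈ U) (y : Eu n) :
    bil (H u) (navV H w u y) (navV H w u y) = navF H w u y ^ 2 := by
  have hl := h.lam_pos hu
  have h1 : navLam H w u * navF H w u y + bil (H u) (w u) y
      = Real.sqrt (navLam H w u * bil (H u) y y + bil (H u) (w u) y ^ 2) := by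
    rw [navF, mul_div_cancel₀ _ hl.ne']
    ring
  have h2 : (navLam H w u * navF H w u y + bil (H u) (w u) y) ^ 2
      = navLam H w u * bil (H u) y y + bil (H u) (w u) y ^ 2 := by
    rw [h1, Real.sq_sqrt (add_nonneg (mul_nonneg hl.le (h.bil_nonneg hu y)) (sq_nonneg _))]
  -- After division by `λ` this says that `F` is a root of `λF² + 2h(w, y)F = h(y, y)`, which is the
  -- expansion of `h(y - F w, y - F w) = F²`.
  have h3 : navLam H w u * (navLam H w u * navF H w u y ^ 2
      + 2 * navF H w u y * bil (H u) (w u) y) = navLam H w u * bil (H u) y y := by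
    linear_combination h2
  have h4 := mul_left_cancel₀ hl.ne' h3
  simp only [navV, bil_sub_left, bil_sub_right, bil_smul_left, bil_smul_right, h.comm hu y (w u)]
  simp only [navLam] at h4
  linear_combination -h4

/-- `F(y) = 1` if and only if `y - w` is a unit vector. -/
theorem navF_eq_one_iff (h : IsNavOn U H w) (hu : u ∈ U) :
    navF H w u y = 1 ↔ bil (H u) (y - w u) (y - w u) = 1 := by
  constructor
  · intro h1
    have h2 := h.bil_navV hu y
    rwa [navV, h1, one_smul, one_pow] at h2
  · intro h1
    have hl := h.lam_pos hu
    have hA := h.bil_nonneg hu y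
    rw [navF, div_eq_one_iff_eq hl.ne', sub_eq_iff_eq_add]
    simp only [bil_sub_left, bil_sub_right, h.comm hu y (w u)] at h1
    have hl' : navLam H w u = 1 - bil (H u) (w u) (w u) := rfl
    rw [Real.sqrt_eq_iff_mul_self_eq_of_pos (by nlinarith)]
    rw [show bil (H u) y y = navLam H w u + 2 * bil (H u) (w u) y by rw [hl']; linarith]
    ring

theorem navF_lt_one_iff (h : IsNavOn U H w) (hu : u ∈ U) :
    navF H w u y < 1 ↔ bil (H u) (y - w u) (y - w u) < 1 := by
  have hl := h.lam_pos hu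
  have hA := h.bil_nonneg hu y
  have hl' : navLam H w u = 1 - bil (H u) (w u) (w u) := rfl
  rw [navF, div_lt_one hl, sub_lt_iff_lt_add]
  simp only [bil_sub_left, bil_sub_right, h.comm hu y (w u)]
  constructor
  · intro h1
    have h2 := lt_of_le_of_lt (Real.sqrt_nonneg _) h1
    rw [Real.sqrt_lt' h2] at h1
    have h3 : navLam H w u * (bil (H u) y y) < navLam H w u * (navLam H w u
        + 2 * bil (H u) (w u) y) := by nlinarith
    have := lt_of_mul_lt_mul_left h3 hl.le
    linarith
  · intro h1
    rw [Real.sqrt_lt' (by linarith)]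
    have h3 : navLam H w u * (bil (H u) y y) < navLam H w u * (navLam H w u
        + 2 * bil (H u) (w u) y) := mul_lt_mul_of_pos_left (by linarith) hl
    nlinarith

theorem smooth_bil {M : Eu n → Matrix (Fin n) (Fin n) ℝ} {Z Y : Eu n → Eu n → Eu n}
    (hM : ∀ i j, ContDiffOn ℝ ∞ (fun u => M u i j) U) (hZ : ∀ i, SmoothOn U (fun u y => Z u y i))
    (hY : ∀ i, SmoothOn U (fun u y => Y u y i)) :
    SmoothOn U (fun u y => bil (M u) (Z u y) (Y u y)) :=
  SmoothOn.sum fun i _ => SmoothOn.sum fun j _ =>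
    ((SmoothOn.of_fst (hM i j)).mul (hZ i)).mul (hY j)

theorem smooth_w_coord (h : IsNavOn U H w) (i : Fin n) : SmoothOn U (fun u _ => w u i) :=
  SmoothOn.of_fst ((EuclideanSpace.proj (𝕜 := ℝ) i).contDiff.comp_contDiffOn h.smooth_w)

theorem isPosHomogOn (h : IsNavOn U H w) : IsPosHomogOn U (navF H w) where
  isOpen := h.isOpen
  smooth := by
    have hA := smooth_bil h.smooth_H smoothOn_coord smoothOn_coord
    have hB := smooth_bil h.smooth_H h.smooth_w_coord smoothOn_coord
    have hw := smooth_bil h.smooth_H h.smooth_w_coord h.smooth_w_coord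
    have hl : SmoothOn U (fun u _ => navLam H w u) := (smoothOn_const 1).sub hw
    have hr := (hl.mul hA).add (hB.mul hB)
    have hs : SmoothOn U fun u y =>
        Real.sqrt (navLam H w u * bil (H u) y y + bil (H u) (w u) y * bil (H u) (w u) y) :=
      ContDiffOn.sqrt hr fun z hz => by
        rw [← sq]
        exact (h.radicand_pos hz.1 hz.2).ne'
    refine ((hs.sub hB).mul (hl.inv fun u hu _ _ => (h.lam_pos hu).ne')).congr fun u _ y _ => ?_
    rw [navF, ← sq, div_eq_mul_inv]
  homog := by
    intro u hu y hy t ht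
    simp only [navF, bil_smul_left, bil_smul_right, zpow_one]
    rw [show navLam H w u * (t * (t * bil (H u) y y)) + (t * bil (H u) (w u) y) ^ 2
      = t ^ 2 * (navLam H w u * bil (H u) y y + bil (H u) (w u) y ^ 2) by ring,
      Real.sqrt_mul (sq_nonneg t), Real.sqrt_sq ht.le]
    ring
  pos := fun u hu y hy => h.F_pos hu hy

theorem hasDerivAt_H (h : IsNavOn U H w) {α : ℝ → Eu n} {a : Eu n} {t : ℝ}
    (hα : HasDerivAt α a t) (hu : α t ∈ U) (i j : Fin n) :
    HasDerivAt (fun s => H (α s) i j) (dmat H (α t) a i j) t :=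
  (((h.smooth_H i j).contDiffAt (h.isOpen.mem_nhds hu)).differentiableAt
    (by simp)).hasFDerivAt.comp_hasDerivAt t hα

theorem hasDerivAt_w (h : IsNavOn U H w) {α : ℝ → Eu n} {a : Eu n} {t : ℝ}
    (hα : HasDerivAt α a t) (hu : α t ∈ U) :
    HasDerivAt (fun s => w (α s)) (fderiv ℝ w (α t) a) t :=
  ((h.smooth_w.contDiffAt (h.isOpen.mem_nhds hu)).differentiableAt
    (by simp)).hasFDerivAt.comp_hasDerivAt t hα

theorem hasDerivAt_H_line (h : IsNavOn U H w) (hu : u ∈ U) (a : Eu n) (i j : Fin n) :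
    HasDerivAt (fun s : ℝ => H (u + s • a) i j) (dmat H u a i j) 0 := by
  simpa only [zero_smul, add_zero] using
    h.hasDerivAt_H (hasDerivAt_line u a 0) (by simpa using hu) i j

theorem hasDerivAt_w_line (h : IsNavOn U H w) (hu : u ∈ U) (a : Eu n) :
    HasDerivAt (fun s : ℝ => w (u + s • a)) (fderiv ℝ w u a) 0 := by
  simpa only [zero_smul, add_zero] using h.hasDerivAt_w (hasDerivAt_line u a 0) (by simpa using hu)

/-- The derivative of `v` in the direction `(a, b)`. -/
def dV (H : Eu n → Matrix (Fin n) (Fin n) ℝ) (w : Eu n → Eu n) (a b u y : Eu n) : Eu n :=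
  b - (navF H w u y • fderiv ℝ w u a + DZ a b (navF H w) u y • w u)

theorem hasDerivAt_navV (h : IsNavOn U H w) (hu : u ∈ U) (hy : y ≠ 0) (a b : Eu n) :
    HasDerivAt (fun s : ℝ => navV H w (u + s • a) (y + s • b)) (dV H w a b u y) 0 := by
  have h1 := (h.isPosHomogOn.smooth.hasDerivAt_line h.isOpen hu hy a b).fun_smul
    (h.hasDerivAt_w_line hu a)
  simp only [zero_smul, add_zero] at h1
  exact (hasDerivAt_line y b 0).fun_sub h1

/-- Implicit differentiation of `h(v, v) = F²`. The derivative of `F` appears on both sides, since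
`v` contains `F w`; collecting it gives the coefficient `ρ`. -/
theorem DZ_F (h : IsNavOn U H w) (hu : u ∈ U) (hy : y ≠ 0) (a b : Eu n) :
    DZ a b (navF H w) u y = (1 / 2 * bil (dmat H u a) (navV H w u y) (navV H w u y)
      + bil (H u) (navV H w u y) b - navF H w u y * bil (H u) (navV H w u y) (fderiv ℝ w u a))
        / navRho H w u y := by
  have hF := h.isPosHomogOn.smooth.hasDerivAt_line h.isOpen hu hy a b
  have h1 := hasDerivAt_bil (h.hasDerivAt_H_line hu a) (h.hasDerivAt_navV hu hy a b)
    (h.hasDerivAt_navV hu hy a b)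
  have h2 := hF.fun_pow 2
  simp only [zero_smul, add_zero] at h1 h2
  have h3 := (h2.congr_of_eventuallyEq (f₁ := fun s : ℝ => bil (H (u + s • a))
    (navV H w (u + s • a) (y + s • b)) (navV H w (u + s • a) (y + s • b))) ?_).unique h1
  · rw [h.comm hu (dV H w a b u y)] at h3
    simp only [dV, bil_sub_right, bil_add_right, bil_smul_right] at h3
    rw [eq_div_iff (h.rho_pos hu hy).ne', navRho]
    norm_num at h3
    linarith
  · have hc : ContinuousAt (fun s : ℝ => u + s • a) 0 := (hasDerivAt_line u a 0).continuousAt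
    filter_upwards [hc.preimage_mem_nhds (h.isOpen.mem_nhds (by simpa using hu))] with s hs
    exact h.bil_navV hs _

theorem DY_F (h : IsNavOn U H w) (hu : u ∈ U) (hy : y ≠ 0) (b : Eu n) :
    DY b (navF H w) u y = bil (H u) (navV H w u y) b / navRho H w u y := by
  have h1 := h.DZ_F hu hy 0 b
  have h0 : dmat H u 0 = 0 := by
    ext i j
    simp [dmat]
  rw [DZ_zero_left, h0] at h1
  rw [h1]
  simp [bil_zero_right, bil_zero_matrix]

theorem DX_F (h : IsNavOn U H w) (hu : u ∈ U) (hy : y ≠ 0) (a : Eu n) :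
    DX a (navF H w) u y = (1 / 2 * bil (dmat H u a) (navV H w u y) (navV H w u y)
      - navF H w u y * bil (H u) (navV H w u y) (fderiv ℝ w u a)) / navRho H w u y := by
  have h1 := h.DZ_F hu hy a 0
  rw [DZ_zero_right, bil_zero_right, add_zero] at h1
  exact h1

theorem DZ_DY_F (h : IsNavOn U H w) (hu : u ∈ U) (hy : y ≠ 0) (a b Y : Eu n) :
    DZ a b (DY Y (navF H w)) u y = ((bil (dmat H u a) (navV H w u y) Y
        + bil (H u) (dV H w a b u y) Y) * navRho H w u y
      - bil (H u) (navV H w u y) Y * (DZ a b (navF H w) u y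
        + (bil (dmat H u a) (navV H w u y) (w u) + bil (H u) (dV H w a b u y) (w u)
          + bil (H u) (navV H w u y) (fderiv ℝ w u a)))) / navRho H w u y ^ 2 := by
  have hF := h.isPosHomogOn.smooth.hasDerivAt_line h.isOpen hu hy a b
  have hV := h.hasDerivAt_navV hu hy a b
  have h1 := hasDerivAt_bil (h.hasDerivAt_H_line hu a) hV (hasDerivAt_const (0 : ℝ) Y)
  have h2 := hF.fun_add (hasDerivAt_bil (h.hasDerivAt_H_line hu a) hV (h.hasDerivAt_w_line hu a))
  have h3 := h1.fun_div h2 (by simpa [navRho] using (h.rho_pos hu hy).ne')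
  simp only [zero_smul, add_zero, bil_zero_right] at h3
  refine (h.isPosHomogOn.smooth.DY h.isOpen Y).DZ_eq h.isOpen hu hy ?_
  refine h3.congr_of_eventuallyEq ?_
  have hc : ContinuousAt (fun s : ℝ => u + s • a) 0 := (hasDerivAt_line u a 0).continuousAt
  have hc' : ContinuousAt (fun s : ℝ => y + s • b) 0 := (hasDerivAt_line y b 0).continuousAt
  filter_upwards [hc.preimage_mem_nhds (h.isOpen.mem_nhds (by simpa using hu)),
    hc'.eventually_ne (by simpa using hy)] with s hs hs'
  rw [h.DY_F hs hs']
  rfl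

/-- The fundamental form of the metric of a navigation datum. -/
theorem bil_fundForm (h : IsNavOn U H w) (hu : u ∈ U) (hy : y ≠ 0) (Z Y : Eu n) :
    bil (fundForm (navF H w) u y) Z Y = navF H w u y / navRho H w u y * (bil (H u) Z Y
        - DY Z (navF H w) u y * bil (H u) (w u) Y - DY Y (navF H w) u y * bil (H u) (w u) Z
        - navLam H w u * DY Z (navF H w) u y * DY Y (navF H w) u y)
      + DY Z (navF H w) u y * DY Y (navF H w) u y := by
  have hr := (h.rho_pos hu hy).ne'
  have h0 : dmat H u 0 = 0 := by
    ext i j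
    simp [dmat]
  rw [h.isPosHomogOn.bil_fundForm hu hy, ← DZ_zero_left, h.isPosHomogOn.DZ_DY_sqF hu hy,
    h.DZ_DY_F hu hy, DZ_zero_left, h0]
  have hZ := h.DY_F hu hy Z
  rw [eq_div_iff hr] at hZ
  have hY := h.DY_F hu hy Y
  rw [eq_div_iff hr] at hY
  simp only [dV, DZ_zero_left, bil_zero_matrix, map_zero, smul_zero, zero_add, bil_zero_right,
    bil_sub_left, bil_smul_left, add_zero, ← hY, navLam, h.comm hu Z (w u)]
  field_simp
  ring

end IsNavOn

end Randers
end

/-! ### Volume density, determinant and S-curvature of a navigation metric -/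

noncomputable section
namespace Randers

open scoped MatrixOrder Matrix.Norms.L2Operator in
theorem exists_transpose_mul_self {n : ℕ} {M : Matrix (Fin n) (Fin n) ℝ} (hM : M.PosDef) :
    ∃ B : Matrix (Fin n) (Fin n) ℝ, M = B.transpose * B := by
  obtain ⟨B, hB⟩ := CStarAlgebra.nonneg_iff_eq_star_mul_self.mp hM.posSemidef.nonneg
  exact ⟨B, by rw [hB, Matrix.star_eq_conjTranspose, Matrix.conjTranspose_eq_transpose_of_trivial]⟩

/-- With `M = Bᵀ B`, the map `y ↦ B (y - w)` carries the ellipsoid onto the unit ball and scales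
volume by `|det B| = √(det M)`. -/
theorem volume_ellipsoid {n : ℕ} {M : Matrix (Fin n) (Fin n) ℝ} (hM : M.PosDef) (w : Eu n) :
    MeasureTheory.volume {y : Eu n | bil M (y - w) (y - w) < 1}
      = ENNReal.ofReal (Real.sqrt M.det)⁻¹ * MeasureTheory.volume (Metric.ball (0 : Eu n) 1) := by
  obtain ⟨B, hB⟩ := exists_transpose_mul_self hM
  have hdet : M.det = B.det ^ 2 := by rw [hB, Matrix.det_mul, Matrix.det_transpose, sq]
  have hB0 : B.det ≠ 0 := fun h0 => by
    have := hM.det_pos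
    rw [hdet, h0] at this
    simp at this
  set f : Eu n →ₗ[ℝ] Eu n := B.toLpLin 2 2 with hf
  have hdf : LinearMap.det f = B.det := LinearMap.det_toLpLin 2 B
  have hn : ∀ Z : Eu n, bil M Z Z = ‖f Z‖ ^ 2 := by
    intro Z
    rw [← dotProduct_mulVec_eq_bil, hB, ← Matrix.mulVec_mulVec, Matrix.dotProduct_mulVec,
      Matrix.vecMul_transpose, EuclideanSpace.norm_sq_eq]
    simp only [dotProduct, Real.norm_eq_abs, sq_abs]
    exact Finset.sum_congr rfl fun i _ => (sq _).symm
  have hset : {y : Eu n | bil M (y - w) (y - w) < 1}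
      = (fun y => y + -w) ⁻¹' (f ⁻¹' Metric.ball (0 : Eu n) 1) := by
    ext y
    simp only [Set.mem_ofPred_eq, Set.mem_preimage, Metric.mem_ball, dist_zero_right, hn,
      ← sub_eq_add_neg]
    rw [sq_lt_one_iff₀ (norm_nonneg _)]
  rw [hset, MeasureTheory.measure_preimage_add_right,
    MeasureTheory.Measure.addHaar_preimage_linearMap _ (by rwa [hdf]), hdf, hdet, Real.sqrt_sq_eq_abs,
    abs_inv]

namespace IsNavOn

variable {n : ℕ} {U : Set (Eu n)} {H : Eu n → Matrix (Fin n) (Fin n) ℝ} {w : Eu n → Eu n}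
  {u y : Eu n}

theorem det_pos (h : IsNavOn U H w) (hu : u ∈ U) : 0 < (H u).det :=
  (posDef_of_bil (h.symm u hu) (h.pos u hu)).det_pos

theorem bhDensity_eq (h : IsNavOn U H w) (hu : u ∈ U) :
    bhDensity (navF H w) u = Real.sqrt (H u).det := by
  have hd := Real.sqrt_pos.2 (h.det_pos hu)
  have hset : {y : Eu n | navF H w u y < 1} = {y : Eu n | bil (H u) (y - w u) (y - w u) < 1} :=
    Set.ext fun y => h.navF_lt_one_iff hu
  have hb : (MeasureTheory.volume (Metric.ball (0 : Eu n) 1)).toReal ≠ 0 :=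
    (ENNReal.toReal_pos (Metric.measure_ball_pos _ _ one_pos).ne' MeasureTheory.measure_ball_lt_top.ne).ne'
  rw [bhDensity, hset, volume_ellipsoid (posDef_of_bil (h.symm u hu) (h.pos u hu)),
    ENNReal.toReal_mul, ENNReal.toReal_ofReal (inv_nonneg.2 hd.le)]
  field_simp

/-- The fundamental form factors as `Pᵀ h P` with `P = r + q ⊗ dF` and `r² = F/ρ`. The matrix
determinant lemma gives `det P = rⁿ (1 + dF(q)/r) = r^(n+1)`. -/
theorem det_fundForm (h : IsNavOn U H w) (hu : u ∈ U) (hy : y ≠ 0) :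
    (fundForm (navF H w) u y).det
      = (navF H w u y / navRho H w u y) ^ (n + 1) * (H u).det := by
  have hF := h.F_pos hu hy
  have hρ := h.rho_pos hu hy
  obtain ⟨r, hr, hr2⟩ : ∃ r : ℝ, 0 < r ∧ r ^ 2 = navF H w u y / navRho H w u y :=
    ⟨Real.sqrt (navF H w u y / navRho H w u y), Real.sqrt_pos.2 (div_pos hF hρ),
      Real.sq_sqrt (div_pos hF hρ).le⟩
  set F := navF H w u y with hFd
  set ρ := navRho H w u y with hρd
  set v := navV H w u y with hvd
  have hr3 : r ^ 2 * ρ = F := by rw [hr2]; field_simp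
  set ξ : Eu n → ℝ := fun Z => DY Z (navF H w) u y with hξ
  have hξv : ∀ Z, ρ * ξ Z = bil (H u) v Z := fun Z => by
    rw [hξ]
    dsimp only
    rw [h.DY_F hu hy, mul_div_cancel₀ _ hρ.ne']
  have hvv : bil (H u) v v = F ^ 2 := h.bil_navV hu y
  have hvw : bil (H u) v (w u) = ρ - F := by
    rw [hρd, navRho]
    ring
  -- Since `y = v + F w` and `dF(y) = F`, this is the vector for which `P y = v`; on the kernel of
  -- `dF` the map `P` is multiplication by `r`.
  set q : Eu n := (1 / F) • v - (r / F) • (v + F • w u) with hq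
  have hξq : ξ q = r ^ 2 - r := by
    have h1 := hξv q
    rw [hq, bil_sub_right, bil_smul_right, bil_smul_right, bil_add_right, bil_smul_right, hvv,
      hvw] at h1
    have h2 : ρ * ξ q = ρ * (r ^ 2 - r) := by
      rw [h1]
      field_simp
      linear_combination -hr3
    exact mul_left_cancel₀ hρ.ne' h2
  set P : Matrix (Fin n) (Fin n) ℝ := Matrix.of fun i j => r * (1 : Matrix (Fin n) (Fin n) ℝ) i j
    + q i * ξ (e j) with hP
  have hPe : ∀ j, (WithLp.toLp 2 fun i => P i j : Eu n) = r • e j + ξ (e j) • q := by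
    intro j
    ext i
    simp only [hP, Matrix.of_apply, PiLp.add_apply, PiLp.smul_apply, smul_eq_mul]
    simp [e, Matrix.one_apply, mul_comm]
  have hlam : navLam H w u = 1 - bil (H u) (w u) (w u) := rfl
  have hg : fundForm (navF H w) u y = P.transpose * H u * P := by
    ext i j
    have h1 : (P.transpose * H u * P) i j
        = bil (H u) (WithLp.toLp 2 fun k => P k i) (WithLp.toLp 2 fun k => P k j) := by
      simp only [Matrix.mul_apply, Matrix.transpose_apply, bil, Finset.sum_mul]
      rw [Finset.sum_comm]
      exact Finset.sum_congr rfl fun a _ => Finset.sum_congr rfl fun b _ => by ring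
    rw [h1, hPe, hPe, ← bil_e (fundForm (navF H w) u y) i j, h.bil_fundForm hu hy]
    have hi := hξv (e i)
    have hj := hξv (e j)
    simp only [hq, bil_add_left, bil_add_right, bil_smul_left, bil_smul_right, bil_sub_left,
      bil_sub_right, h.comm hu _ v, h.comm hu (e i) (w u), hvv, hvw, ← hi, ← hj]
    change F / ρ * (bil (H u) (e i) (e j) - ξ (e i) * bil (H u) (w u) (e j)
      - ξ (e j) * bil (H u) (w u) (e i) - navLam H w u * ξ (e i) * ξ (e j)) + ξ (e i) * ξ (e j) = _
    rw [hlam, ← hr2, ← hr3]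
    field_simp
    ring
  have hdP : P.det = r ^ (n + 1) := by
    have h1 : P = r • (1 + Matrix.replicateCol Unit (fun i => q i / r)
        * Matrix.replicateRow Unit (fun j => ξ (e j))) := by
      ext i j
      simp only [hP, Matrix.of_apply, Matrix.smul_apply, Matrix.add_apply, Matrix.mul_apply,
        Matrix.replicateCol_apply, Matrix.replicateRow_apply, Finset.univ_unique,
        Finset.sum_singleton, smul_eq_mul]
      field_simp
    have h2 : (fun j => ξ (e j)) ⬝ᵥ (fun i => q i / r) = ξ q / r := by
      rw [hξ]
      simp only [dotProduct]
      rw [← DY_sum q, Finset.sum_div]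
      refine Finset.sum_congr rfl fun i _ => ?_
      change DY (e i) (navF H w) u y * (q i / r) = q i * DY (e i) (navF H w) u y / r
      ring
    rw [h1, Matrix.det_smul, Matrix.det_one_add_replicateCol_mul_replicateRow, h2, hξq,
      Fintype.card_fin]
    field_simp
    ring
  rw [hg, Matrix.det_mul, Matrix.det_mul, Matrix.det_transpose, hdP, ← hr2]
  ring

theorem isFinslerOn (h : IsNavOn U H w) : IsFinslerOn U (navF H w) where
  toIsPosHomogOn := h.isPosHomogOn
  det_ne_zero := fun u hu y hy => by
    rw [h.det_fundForm hu hy]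
    exact (mul_pos (pow_pos (div_pos (h.F_pos hu hy) (h.rho_pos hu hy)) _) (h.det_pos hu)).ne'

/-- Expresses the factor of `det g` through `dF`, whose derivative along the spray is supplied by
`spray_DY`. -/
theorem F_div_rho (h : IsNavOn U H w) (hu : u ∈ U) (hy : y ≠ 0) :
    navF H w u y / navRho H w u y = 1 - DY (w u) (navF H w) u y := by
  have hρ := h.rho_pos hu hy
  rw [h.DY_F hu hy, eq_sub_iff_add_eq, ← add_div, div_eq_one_iff_eq hρ.ne']
  rfl

theorem hasDerivAt_F_div_rho (h : IsNavOn U H w) (hu : u ∈ U) (hy : y ≠ 0) (a b : Eu n) :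
    HasDerivAt (fun s : ℝ => navF H w (u + s • a) (y + s • b) / navRho H w (u + s • a) (y + s • b))
      (-(DY (fderiv ℝ w u a) (navF H w) u y + DZ a b (DY (w u) (navF H w)) u y)) 0 := by
  have hα := hasDerivAt_line u a 0
  have hβ := hasDerivAt_line y b 0
  have h1 := (h.isPosHomogOn.smooth.hasDerivAt_DY h.isOpen hα hβ (h.hasDerivAt_w hα
    (by simpa using hu)) (by simpa using hu) (by simpa using hy)).const_sub 1
  simp only [zero_smul, add_zero] at h1
  refine h1.congr_of_eventuallyEq ?_
  filter_upwards [hα.continuousAt.preimage_mem_nhds (h.isOpen.mem_nhds (by simpa using hu)),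
    hβ.continuousAt.eventually_ne (by simpa using hy)] with s hs hs'
  exact h.F_div_rho hs hs'

/-- The symmetric form `½ (L_w h)(Z, Z)`. -/
def killing (H : Eu n → Matrix (Fin n) (Fin n) ℝ) (w : Eu n → Eu n) (u Z : Eu n) : ℝ :=
  1 / 2 * bil (dmat H u (w u)) Z Z + bil (H u) Z (fderiv ℝ w u Z)

/-- The spray derivative of `dF(w)`, with `w` frozen, is the position derivative of `F` along `w`.
In the explicit formulas the term `-h(v, Dw(w))` then combines with `h(v, Dw(y))` into `h(v,
Dw(v))`, because `y = v + w`. -/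
theorem spray_F_div_rho (h : IsNavOn U H w) (hu : u ∈ U) (hy : y ≠ 0) (hF : navF H w u y = 1) :
    DY (fderiv ℝ w u y) (navF H w) u y + spray (navF H w) (DY (w u) (navF H w)) u y
      = navF H w u y / navRho H w u y * killing H w u (y - w u) := by
  have hv : navV H w u y = y - w u := by rw [navV, hF, one_smul]
  rw [h.isFinslerOn.spray_DY hu hy, h.DX_F hu hy, h.DY_F hu hy, hF, hv, killing]
  simp only [map_sub, bil_sub_right]
  ring

/-- The S-curvature of the metric of a navigation datum. -/
theorem localS_eq (h : IsNavOn U H w) (hu : u ∈ U) (hy : y ≠ 0) (hF : navF H w u y = 1) :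
    localS (navF H w) u y = -((n + 1) / 2) * killing H w u (y - w u) := by
  have hd := h.det_pos hu
  have hc : 0 < navF H w u y / navRho H w u y := div_pos (h.F_pos hu hy) (h.rho_pos hu hy)
  have hFin := h.isFinslerOn
  set c := navF H w u y / navRho H w u y with hcd
  set d := ((H u).adjugate * dmat H u y).trace with hdd
  have hdet : HasDerivAt (fun s : ℝ => (H (u + s • y)).det) d 0 := by
    have := hasDerivAt_det (h.hasDerivAt_H_line hu y)
    simpa only [zero_smul, add_zero] using this
  have hspray : spray (navF H w) (fun u y => (fundForm (navF H w) u y).det) u y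
      = (n + 1) * c ^ n * (-(c * killing H w u (y - w u))) * (H u).det + c ^ (n + 1) * d := by
    have hs : SmoothOn U (fun u y => (fundForm (navF H w) u y).det) :=
      SmoothOn.det (M := fun i j u y => fundForm (navF H w) u y i j) hFin.smooth_fundForm
    refine hs.DZ_eq h.isOpen hu hy ?_
    have h1 := h.hasDerivAt_F_div_rho hu hy y ((-2 : ℝ) • geodVec (navF H w) u y)
    have h2 := h.spray_F_div_rho hu hy hF
    rw [spray] at h2
    rw [h2] at h1
    have h3 := (h1.fun_pow (n + 1)).fun_mul hdet
    simp only [zero_smul, add_zero, Nat.cast_add, Nat.cast_one, Nat.add_sub_cancel] at h3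
    refine h3.congr_of_eventuallyEq ?_
    filter_upwards [(hasDerivAt_line u y 0).continuousAt.preimage_mem_nhds
      (h.isOpen.mem_nhds (by simpa using hu)),
      (hasDerivAt_line y ((-2 : ℝ) • geodVec (navF H w) u y) 0).continuousAt.eventually_ne
        (by simpa using hy)] with s hs hs'
    exact h.det_fundForm hs hs'
  have hσ : ∑ i, y i * fderiv ℝ (fun u' => Real.log (bhDensity (navF H w) u')) u (e i)
      = 1 / 2 * (d / (H u).det) := by
    have h1 : (fun u' => Real.log (bhDensity (navF H w) u'))
        =ᶠ[𝓝 u] fun u' => 1 / 2 * Real.log (H u').det := by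
      filter_upwards [h.isOpen.mem_nhds hu] with u' hu'
      rw [h.bhDensity_eq hu', Real.log_sqrt (h.det_pos hu').le]
      ring
    have hdiff : DifferentiableAt ℝ (fun u' => 1 / 2 * Real.log (H u').det) u := by
      have hdd : DifferentiableAt ℝ (fun u' => (H u').det) u := by
        simp only [Matrix.det_apply']
        have hc : ContDiffAt ℝ ∞ (fun u' => ∑ σ : Equiv.Perm (Fin n),
            ((Equiv.Perm.sign σ : ℤ) : ℝ) * ∏ i, H u' (σ i) i) u :=
          ContDiffAt.sum fun σ _ => contDiffAt_const.mul (contDiffAt_prod fun i _ =>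
            (h.smooth_H (σ i) i).contDiffAt (h.isOpen.mem_nhds hu))
        exact hc.differentiableAt (by simp)
      exact (hdd.log hd.ne').const_mul _
    rw [h1.fderiv_eq]
    have h2 : ∑ i, y i * fderiv ℝ (fun u' => 1 / 2 * Real.log (H u').det) u (e i)
        = fderiv ℝ (fun u' => 1 / 2 * Real.log (H u').det) u y := by
      conv_rhs => rw [← sum_smul_e y]
      simp only [map_sum, map_smul, smul_eq_mul]
    rw [h2]
    have hline := hasDerivAt_line u y 0
    have hdiff' : HasFDerivAt (fun u' => 1 / 2 * Real.log (H u').det)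
        (fderiv ℝ (fun u' => 1 / 2 * Real.log (H u').det) u) (u + (0 : ℝ) • y) := by
      rw [zero_smul, add_zero]
      exact hdiff.hasFDerivAt
    have h3 := hdiff'.comp_hasDerivAt (0 : ℝ) hline
    have h4 := (hdet.log (by simpa using hd.ne')).const_mul (1 / 2)
    simp only [zero_smul, add_zero] at h4
    exact h3.unique h4
  -- The logarithmic derivatives of `det h` from `det g` and from `σ` cancel; the power `n + 1` of
  -- `F/ρ` leaves the stated multiple of the Killing form.
  rw [localS, hσ, hFin.sum_dy_geodCoeff hu hy, hspray, h.det_fundForm hu hy, ← hcd]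
  field_simp
  ring

/-- The polarization of `killing`. -/
theorem killing_polar (h : IsNavOn U H w) (hu : u ∈ U) {k : ℝ}
    (hk : ∀ Z : Eu n, bil (H u) Z Z = 1 → killing H w u Z = -2 * k) (X Y : Eu n) :
    bil (dmat H u (w u)) X Y + bil (H u) X (fderiv ℝ w u Y) + bil (H u) Y (fderiv ℝ w u X)
      = -4 * k * bil (H u) X Y := by
  -- The hypothesis concerns unit vectors only; both sides being quadratic, rescaling extends it to
  -- all `Z`, after which `X + Y` can be inserted.
  have hq : ∀ Z : Eu n, killing H w u Z = -2 * k * bil (H u) Z Z := by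
    intro Z
    by_cases hZ : Z = 0
    · simp [hZ, killing, bil_zero_left]
    · have h1 := h.pos u hu Z hZ
      set t := Real.sqrt (bil (H u) Z Z) with ht
      have ht0 : 0 < t := Real.sqrt_pos.2 h1
      have ht2 : t ^ 2 = bil (H u) Z Z := Real.sq_sqrt h1.le
      have h2 := hk (t⁻¹ • Z) (by
        rw [bil_smul_left, bil_smul_right, ← ht2]
        field_simp)
      simp only [killing, bil_smul_left, bil_smul_right, map_smul] at h2
      rw [killing, ← ht2]
      field_simp at h2
      linear_combination h2 / 2
  have h1 := hq (X + Y)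
  have h2 := hq X
  have h3 := hq Y
  simp only [killing, map_add, bil_add_left, bil_add_right] at h1 h2 h3
  rw [h.dmat_comm hu (w u) Y X, h.comm hu Y X] at h1
  linear_combination h1 - h2 - h3

end IsNavOn

end Randers
end

/-! ### Comparison of the Chern and Levi-Civita connections along normals -/

noncomputable section
namespace Randers

namespace IsNavOn

variable {n : ℕ} {U : Set (Eu n)} {H : Eu n → Matrix (Fin n) (Fin n) ℝ} {w : Eu n → Eu n}
  {u y : Eu n}

theorem sum_dmat (H : Eu n → Matrix (Fin n) (Fin n) ℝ) (u X Z Y : Eu n) :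
    ∑ i, ∑ j, ∑ k, dmat H u (e k) i j * Z i * Y j * X k = bil (dmat H u X) Z Y := by
  refine Finset.sum_congr rfl fun i _ => Finset.sum_congr rfl fun j _ => ?_
  have h1 : dmat H u X i j = ∑ k, X k * dmat H u (e k) i j := by
    conv_lhs => rw [← sum_smul_e X]
    simp only [dmat, Matrix.of_apply, map_sum, map_smul, smul_eq_mul]
  rw [h1, Finset.sum_mul, Finset.sum_mul]
  exact Finset.sum_congr rfl fun k _ => by ring

/-- The Levi-Civita connection, contracted with two vectors. -/
theorem bil_christoffel (h : IsNavOn U H w) (hu : u ∈ U) (X Z Y : Eu n) :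
    bil (H u) (conVec (christoffel H u) X Z) Y
      = 1 / 2 * (bil (dmat H u X) Z Y + bil (dmat H u Z) X Y - bil (dmat H u Y) X Z) := by
  have hs : (H u).transpose = H u := by
    ext i j
    exact h.symm u hu j i
  rw [bil_solve (h.det_pos hu).ne' hs _
    (fun i => sum_christoffel_left (fun l => (H u)⁻¹ i l) (fun k i j => dmat H u (e k) i j) X Z) Y,
    sum_christoffel (fun k i j => dmat H u (e k) i j) X Z Y, sum_dmat, sum_dmat, sum_dmat,
    h.dmat_comm hu X Y Z]

theorem add_w_ne_zero (h : IsNavOn U H w) (hu : u ∈ U) {ν : Eu n} (hν : bil (H u) ν ν = 1) :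
    ν + w u ≠ 0 := by
  intro h0
  have h1 := h.lt_one u hu
  rw [eq_neg_of_add_eq_zero_left h0, bil_neg_left, bil_neg_right, neg_neg] at hν
  linarith

theorem navF_add_w (h : IsNavOn U H w) (hu : u ∈ U) {ν : Eu n} (hν : bil (H u) ν ν = 1) :
    navF H w u (ν + w u) = 1 := by
  rw [h.navF_eq_one_iff hu]
  simpa using hν

theorem DY_F_add_w (h : IsNavOn U H w) (hu : u ∈ U) {ν : Eu n} (hν : bil (H u) ν ν = 1)
    (Y : Eu n) :
    DY Y (navF H w) u (ν + w u) = bil (H u) ν Y / navRho H w u (ν + w u) := by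
  rw [h.DY_F hu (h.add_w_ne_zero hu hν), navV, h.navF_add_w hu hν, one_smul, add_sub_cancel_right]

/-- For `Y` orthogonal to `ν` the derivative `dF(Y)` vanishes at `ν + w`, so `g` reduces to `ρ⁻¹ h`
apart from a correction by the normal component of `Z`. -/
theorem bil_fundForm_tangent (h : IsNavOn U H w) (hu : u ∈ U) {ν Y : Eu n}
    (hν : bil (H u) ν ν = 1) (hY : bil (H u) ν Y = 0) (Z : Eu n) :
    bil (fundForm (navF H w) u (ν + w u)) Z Y = (navRho H w u (ν + w u))⁻¹ * (bil (H u) Z Y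
      - bil (H u) ν Z / navRho H w u (ν + w u) * bil (H u) (w u) Y) := by
  rw [h.bil_fundForm hu (h.add_w_ne_zero hu hν), h.DY_F_add_w hu hν, h.DY_F_add_w hu hν, hY,
    h.navF_add_w hu hν]
  ring

theorem DX_DY_sqF_tangent (h : IsNavOn U H w) (hu : u ∈ U) {ν Y : Eu n}
    (hν : bil (H u) ν ν = 1) (hY : bil (H u) ν Y = 0) (X : Eu n) :
    DX X (DY Y (sqF (navF H w))) u (ν + w u) = 2 * ((navRho H w u (ν + w u))⁻¹ *
      (bil (dmat H u X) ν Y - bil (H u) (fderiv ℝ w u X) Y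
        - DX X (navF H w) u (ν + w u) * bil (H u) (w u) Y)) := by
  have hy := h.add_w_ne_zero hu hν
  have hρ := (h.rho_pos hu hy).ne'
  have hF := h.navF_add_w hu hν
  have hv : navV H w u (ν + w u) = ν := by rw [navV, hF, one_smul, add_sub_cancel_right]
  rw [← DZ_zero_right, h.isPosHomogOn.DZ_DY_sqF hu hy, h.DY_F hu hy, h.DZ_DY_F hu hy, hv, hY, hF,
    dV, hF, DZ_zero_right, one_smul, zero_sub, bil_neg_left, bil_add_left, bil_smul_left]
  field_simp
  ring

/-- Differentiates the explicit fundamental form along the spray. At the point `dF(X) = dF(Y) = 0`,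
so products of both factors contribute nothing and a single factor contributes only its own
derivative, known from `spray_DY`. The factor `F/ρ` contributes the Killing form. -/
theorem spray_DY_DY_sqF_tangent (h : IsNavOn U H w) (hu : u ∈ U) {ν X Y : Eu n}
    (hν : bil (H u) ν ν = 1) (hX : bil (H u) ν X = 0) (hY : bil (H u) ν Y = 0) :
    spray (navF H w) (DY X (DY Y (sqF (navF H w)))) u (ν + w u)
      = 2 * ((navRho H w u (ν + w u))⁻¹ * (bil (dmat H u (ν + w u)) X Y
        - killing H w u ν * bil (H u) X Y
        - DX X (navF H w) u (ν + w u) * bil (H u) (w u) Y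
        - DX Y (navF H w) u (ν + w u) * bil (H u) (w u) X)) := by
  have hy := h.add_w_ne_zero hu hν
  have hF := h.navF_add_w hu hν
  have hsm := h.isPosHomogOn.smooth
  set y := ν + w u with hyd
  set b := (-2 : ℝ) • geodVec (navF H w) u y with hb
  have hc := h.hasDerivAt_F_div_rho hu hy y b
  have hcs := h.spray_F_div_rho hu hy hF
  rw [spray, ← hb, hF] at hcs
  rw [hcs, show y - w u = ν by rw [hyd, add_sub_cancel_right]] at hc
  have hd : ∀ Z, HasDerivAt (fun s : ℝ => DY Z (navF H w) (u + s • y) (y + s • b))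
      (DX Z (navF H w) u y) 0 := by
    intro Z
    have h1 := (hsm.DY h.isOpen Z).hasDerivAt_line h.isOpen hu hy y b
    have h2 := h.isFinslerOn.spray_DY hu hy Z
    rw [spray, ← hb] at h2
    rwa [h2] at h1
  have hw := h.hasDerivAt_w_line hu y
  have hH := h.hasDerivAt_H_line hu y
  have hZ : ∀ Z, HasDerivAt (fun s : ℝ => bil (H (u + s • y)) (w (u + s • y)) Z) _ 0 := fun Z =>
    hasDerivAt_bil hH hw (hasDerivAt_const (0 : ℝ) Z)
  have hXY := hasDerivAt_bil hH (hasDerivAt_const (0 : ℝ) X) (hasDerivAt_const (0 : ℝ) Y)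
  have hl := (hasDerivAt_bil hH hw hw).const_sub 1
  have hX0 : DY X (navF H w) u y = 0 := by rw [hyd, h.DY_F_add_w hu hν, hX, zero_div]
  have hY0 : DY Y (navF H w) u y = 0 := by rw [hyd, h.DY_F_add_w hu hν, hY, zero_div]
  have hall := (hc.fun_mul (((hXY.fun_sub ((hd X).fun_mul (hZ Y))).fun_sub
    ((hd Y).fun_mul (hZ X))).fun_sub ((hl.fun_mul (hd X)).fun_mul (hd Y)))).fun_add
      ((hd X).fun_mul (hd Y))
  simp only [zero_smul, add_zero, hX0, hY0, hF, bil_zero_left, bil_zero_right, mul_zero,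
    zero_mul, sub_zero] at hall
  have hfin := hall.const_mul 2
  rw [spray, ← hb]
  refine ((h.isPosHomogOn.smooth_sqF.DY h.isOpen Y).DY h.isOpen X).DZ_eq h.isOpen hu hy ?_
  have hval : 2 * ((navRho H w u y)⁻¹ * (bil (dmat H u y) X Y - killing H w u ν * bil (H u) X Y
        - DX X (navF H w) u y * bil (H u) (w u) Y - DX Y (navF H w) u y * bil (H u) (w u) X))
      = 2 * (-(1 / navRho H w u y * killing H w u ν) * bil (H u) X Y
        + 1 / navRho H w u y * (bil (dmat H u y) X Y - DX X (navF H w) u y * bil (H u) (w u) Y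
          - DX Y (navF H w) u y * bil (H u) (w u) X)) := by ring
  rw [hval]
  refine hfin.congr_of_eventuallyEq ?_
  filter_upwards [(hasDerivAt_line u y 0).continuousAt.preimage_mem_nhds
    (h.isOpen.mem_nhds (by simpa using hu)),
    (hasDerivAt_line y b 0).continuousAt.eventually_ne (by simpa using hy)] with s hs hs'
  have h1 := h.isPosHomogOn.bil_fundForm hs hs' X Y
  rw [h.bil_fundForm hs hs'] at h1
  have h2 : DY X (DY Y (sqF (navF H w))) (u + s • y) (y + s • b) = 2 * (1 / 2 *
      DY X (DY Y (sqF (navF H w))) (u + s • y) (y + s • b)) := by ring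
  rw [h2, ← h1]
  rfl

/-- Comparison of the Chern connection of `F`, with reference vector `ν + w`, and the Levi-Civita
connection of `h`, for a unit normal vector `ν` and a homothetic field `w`. -/
theorem bil_covDeriv (h : IsNavOn U H w) (hu : u ∈ U) {ν X Y δ : Eu n} {k : ℝ}
    (hν : bil (H u) ν ν = 1) (hX : bil (H u) ν X = 0) (hY : bil (H u) ν Y = 0)
    (hδ : bil (H u) ν δ = -(1 / 2) * bil (dmat H u X) ν ν)
    (hk : ∀ Z : Eu n, bil (H u) Z Z = 1 → killing H w u Z = -2 * k) :
    bil (fundForm (navF H w) u (ν + w u))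
        (δ + fderiv ℝ w u X + conVec (chern (navF H w) u (ν + w u)) X (ν + w u)) Y
      = (navRho H w u (ν + w u))⁻¹ *
        (bil (H u) (δ + conVec (christoffel H u) X ν) Y - k * bil (H u) X Y) := by
  have hy := h.add_w_ne_zero hu hν
  have hρ := (h.rho_pos hu hy).ne'
  have hv : navV H w u (ν + w u) = ν := by
    rw [navV, h.navF_add_w hu hν, one_smul, add_sub_cancel_right]
  have hFX := h.DX_F hu hy X
  rw [hv, h.navF_add_w hu hν, one_mul, eq_div_iff hρ] at hFX
  have hpol := h.killing_polar hu hk X Y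
  have hadd : bil (dmat H u (ν + w u)) X Y = bil (dmat H u ν) X Y + bil (dmat H u (w u)) X Y := by
    rw [← bil_add_matrix]
    congr 1
    ext i j
    simp [dmat]
  rw [bil_add_left, h.bil_fundForm_tangent hu hν hY, h.isFinslerOn.bil_chern hu hy,
    h.DX_DY_sqF_tangent hu hν hY, h.DX_DY_sqF_tangent hu hν hX,
    h.spray_DY_DY_sqF_tangent hu hν hX hY, hk ν hν, bil_add_left, bil_add_left (H u),
    h.bil_christoffel hu, bil_add_right, hδ, hadd]
  rw [h.comm hu (fderiv ℝ w u Y) X, h.dmat_comm hu Y ν X]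
  rw [h.comm hu Y] at hpol
  field_simp
  -- The terms in `h(w, Y)` cancel by the formula for `D_X F` together with `hδ`. The remaining wind
  -- terms form `½(L_w h)(X, Y) = -2k h(X, Y)`; the spray term contributes `+k h(X, Y)` through the
  -- Killing form at `ν`, so the total is `-k h(X, Y)`.
  linear_combination (-8 * bil (H u) (w u) Y) * hFX + (4 * navRho H w u (ν + w u)) * hpol

end IsNavOn

end Randers
end

noncomputable section
namespace Randers

/-! ### Locality of the Finsler objects -/

section Congr

variable {n : ℕ} {U : Set (Eu n)} {F F' : Eu n → Eu n → ℝ} {u : Eu n}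

/-- `f` and `g` agree over `U`. -/
def AgreeOn {n : ℕ} (U : Set (Eu n)) (f g : Eu n → Eu n → ℝ) : Prop := ∀ u ∈ U, ∀ y, f u y = g u y

theorem AgreeOn.dy {f g : Eu n → Eu n → ℝ} (h : AgreeOn U f g) (i : Fin n) :
    AgreeOn U (dy i f) (dy i g) := by
  intro u hu y
  rw [Randers.dy, Randers.dy, show (fun y' => f u y') = fun y' => g u y' from funext (h u hu)]

theorem AgreeOn.dx {f g : Eu n → Eu n → ℝ} (h : AgreeOn U f g) (hU : IsOpen U) (i : Fin n) :
    AgreeOn U (dx i f) (dx i g) := by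
  intro u hu y
  rw [Randers.dx, Randers.dx, Filter.EventuallyEq.fderiv_eq]
  filter_upwards [hU.mem_nhds hu] with u' hu' using h u' hu' y

theorem AgreeOn.sqF (h : AgreeOn U F F') : AgreeOn U (sqF F) (sqF F') := by
  intro u hu y
  rw [Randers.sqF, Randers.sqF, h u hu y]

theorem AgreeOn.fundForm (h : AgreeOn U F F') (hu : u ∈ U) (y : Eu n) :
    fundForm F u y = fundForm F' u y := by
  ext i j
  simp only [Randers.fundForm, Matrix.of_apply]
  rw [(h.sqF.dy j).dy i u hu y]

theorem AgreeOn.geodCoeff (h : AgreeOn U F F') (hU : IsOpen U) (i : Fin n) :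
    AgreeOn U (geodCoeff F i) (geodCoeff F' i) := by
  intro u hu y
  simp only [Randers.geodCoeff, h.fundForm hu y, (h.sqF.dx hU _) u hu y]
  simp only [fun l k => (h.sqF.dy l).dx hU k u hu y]

theorem AgreeOn.horizDeriv (h : AgreeOn U F F') (hU : IsOpen U) {f g : Eu n → Eu n → ℝ}
    (hf : AgreeOn U f g) (j : Fin n) : AgreeOn U (horizDeriv F j f) (horizDeriv F' j g) := by
  intro u hu y
  simp only [Randers.horizDeriv, nonlinConn, hf.dx hU j u hu y, hf.dy _ u hu y,
    fun m => (h.geodCoeff hU m).dy j u hu y]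

theorem AgreeOn.chern (h : AgreeOn U F F') (hU : IsOpen U) (hu : u ∈ U) (y : Eu n) :
    chern F u y = chern F' u y := by
  have hg : ∀ i j, AgreeOn U (fun u y => Randers.fundForm F u y i j)
      (fun u y => Randers.fundForm F' u y i j) := by
    intro i j u hu y
    change Randers.fundForm F u y i j = Randers.fundForm F' u y i j
    rw [h.fundForm hu y]
  funext i j k
  simp only [Randers.chern, h.fundForm hu y, fun l i j => h.horizDeriv hU (hg i j) l u hu y]

/-- The density involves the whole unit ball of a fibre, which is why agreement is required for
every direction and only localized in the position. -/
theorem AgreeOn.localS (h : AgreeOn U F F') (hU : IsOpen U) (hu : u ∈ U) (y : Eu n) :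
    localS F u y = localS F' u y := by
  have h1 : (fun u' => Real.log (bhDensity F u')) =ᶠ[𝓝 u]
      fun u' => Real.log (bhDensity F' u') := by
    filter_upwards [hU.mem_nhds hu] with u' hu'
    simp only [bhDensity, h u' hu']
  simp only [Randers.localS, fun i => (h.geodCoeff hU i).dy i u hu y, h1.fderiv_eq]

end Congr

/-! ### Charts -/

section Charts

variable {n : ℕ} {N : Type*} [TopologicalSpace N] [ChartedSpace (Eu n) N]
  {p q : N} {u : Eu n}

theorem coordVec_add (p q : N) (v v' : TangentSpace (𝓡 n) q) :
    coordVec p q (v + v') = coordVec p q v + coordVec p q v' :=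
  map_add (mfderiv (𝓡 n) 𝓘(ℝ, Eu n) (extChartAt (𝓡 n) p) q) v v'

theorem coordVec_sub (p q : N) (v v' : TangentSpace (𝓡 n) q) :
    coordVec p q (v - v') = coordVec p q v - coordVec p q v' :=
  map_sub (mfderiv (𝓡 n) 𝓘(ℝ, Eu n) (extChartAt (𝓡 n) p) q) v v'

theorem coordVec_smul (p q : N) (c : ℝ) (v : TangentSpace (𝓡 n) q) :
    coordVec p q (c • v) = c • coordVec p q v :=
  map_smul (mfderiv (𝓡 n) 𝓘(ℝ, Eu n) (extChartAt (𝓡 n) p) q) c v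

theorem coordVec_zero (p q : N) : coordVec p q (0 : TangentSpace (𝓡 n) q) = 0 :=
  map_zero (mfderiv (𝓡 n) 𝓘(ℝ, Eu n) (extChartAt (𝓡 n) p) q)

/-- Points of the chart domain come from the target of the chart. -/
theorem exists_target (hq : q ∈ (chartAt (Eu n) p).source) :
    ∃ u ∈ (extChartAt (𝓡 n) p).target, (extChartAt (𝓡 n) p).symm u = q := by
  rw [← extChartAt_source (𝓡 n)] at hq
  exact ⟨_, (extChartAt (𝓡 n) p).map_source hq, (extChartAt (𝓡 n) p).left_inv hq⟩

theorem symm_mem_source (hu : u ∈ (extChartAt (𝓡 n) p).target) :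
    (extChartAt (𝓡 n) p).symm u ∈ (chartAt (Eu n) p).source := by
  rw [← extChartAt_source (𝓡 n)]
  exact (extChartAt (𝓡 n) p).map_target hu

/-- A vector field in the chart around `p`. -/
def localField (W : ∀ x : N, TangentSpace (𝓡 n) x) (p : N) (u : Eu n) : Eu n :=
  coordVec p ((extChartAt (𝓡 n) p).symm u) (W ((extChartAt (𝓡 n) p).symm u))

theorem localField_extChartAt (W : ∀ x : N, TangentSpace (𝓡 n) x)
    (hq : q ∈ (chartAt (Eu n) p).source) :
    localField W p (extChartAt (𝓡 n) p q) = coordVec p q (W q) := by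
  obtain ⟨u, hu, rfl⟩ := exists_target hq
  rw [(extChartAt (𝓡 n) p).right_inv hu, localField]

variable [IsManifold (𝓡 n) ∞ N]

theorem isManifold_one (n : ℕ) (N : Type*) [TopologicalSpace N] [ChartedSpace (Eu n) N]
    [IsManifold (𝓡 n) ∞ N] : IsManifold (𝓡 n) 1 N :=
  IsManifold.of_le (m := 1) (n := ∞) (by simp)

/-- Links chart components to the bundle trivialization, so that smoothness of sections of the
tangent bundle can be read off in coordinates. -/
theorem coordVec_eq (hq : q ∈ (chartAt (Eu n) p).source) (v : TangentSpace (𝓡 n) q) :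
    coordVec p q v = (trivializationAt (Eu n) (TangentSpace (𝓡 n)) p ⟨q, v⟩).2 := by
  have := isManifold_one n N
  have h1 := TangentBundle.continuousLinearMapAt_trivializationAt (I := 𝓡 n) hq
  have h2 := congrArg (fun L => L v) h1
  rw [Bundle.Trivialization.continuousLinearMapAt_apply,
    Bundle.Trivialization.coe_linearMapAt_of_mem _ (by simpa using hq)] at h2
  exact h2.symm

theorem coordVec_chartVec (hu : u ∈ (extChartAt (𝓡 n) p).target) (y : Eu n) :
    coordVec p ((extChartAt (𝓡 n) p).symm u) (chartVec p u y) = y := by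
  have := isManifold_one n N
  have h1 := mfderiv_extChartAt_comp_mfderivWithin_extChartAt_symm (I := 𝓡 n) hu
  rw [(𝓡 n).range_eq_univ, mfderivWithin_univ] at h1
  exact congrArg (fun L => L y) h1

theorem chartVec_coordVec (hu : u ∈ (extChartAt (𝓡 n) p).target)
    (v : TangentSpace (𝓡 n) ((extChartAt (𝓡 n) p).symm u)) :
    chartVec p u (coordVec p ((extChartAt (𝓡 n) p).symm u) v) = v := by
  have := isManifold_one n N
  have h1 := mfderivWithin_extChartAt_symm_comp_mfderiv_extChartAt (I := 𝓡 n) hu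
  rw [(𝓡 n).range_eq_univ, mfderivWithin_univ] at h1
  exact congrArg (fun L => L v) h1

theorem bil_riemMatrix (h : RiemMetric n N) (p : N) (u a b : Eu n) :
    bil (riemMatrix h p u) a b
      = h.inner ((extChartAt (𝓡 n) p).symm u) (chartVec p u a) (chartVec p u b) := by
  have hlin : ∀ c : Eu n, chartVec p u c = ∑ i, c i • chartVec p u (e i) := by
    intro c
    have hL : ∀ L : Eu n →L[ℝ] Eu n, L c = ∑ i, c i • L (e i) := fun L => by
      conv_lhs => rw [← sum_smul_e c]
      simp only [map_sum, map_smul]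
    exact hL (mfderiv 𝓘(ℝ, Eu n) (𝓡 n) (extChartAt (𝓡 n) p).symm u)
  rw [hlin a, hlin b]
  simp only [map_sum, map_smul, sum_apply, smul_apply, smul_eq_mul,
    bil, riemMatrix, Matrix.of_apply, Finset.mul_sum]
  rw [Finset.sum_comm]
  exact Finset.sum_congr rfl fun i _ => Finset.sum_congr rfl fun j _ => by ring

theorem bil_riemMatrix_coordVec (h : RiemMetric n N) (hq : q ∈ (chartAt (Eu n) p).source)
    (a b : TangentSpace (𝓡 n) q) :
    bil (riemMatrix h p (extChartAt (𝓡 n) p q)) (coordVec p q a) (coordVec p q b)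
      = h.inner q a b := by
  obtain ⟨u, hu, rfl⟩ := exists_target hq
  rw [(extChartAt (𝓡 n) p).right_inv hu, bil_riemMatrix, chartVec_coordVec hu,
    chartVec_coordVec hu]

theorem localRep_coordVec (F : ∀ x : N, TangentSpace (𝓡 n) x → ℝ)
    (hq : q ∈ (chartAt (Eu n) p).source) (y : TangentSpace (𝓡 n) q) :
    localRep F p (extChartAt (𝓡 n) p q) (coordVec p q y) = F q y := by
  obtain ⟨u, hu, rfl⟩ := exists_target hq
  rw [(extChartAt (𝓡 n) p).right_inv hu, localRep, chartVec_coordVec hu]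

theorem contMDiffOn_iff_coordVec (V : ∀ u : Eu n, TangentSpace (𝓡 n) ((extChartAt (𝓡 n) p).symm u)) :
    ContMDiffOn 𝓘(ℝ, Eu n) (𝓡 n).tangent ∞
      (fun u => (⟨(extChartAt (𝓡 n) p).symm u, V u⟩ : TangentBundle (𝓡 n) N))
      (extChartAt (𝓡 n) p).target
    ↔ ContDiffOn ℝ ∞ (fun u => coordVec p ((extChartAt (𝓡 n) p).symm u) (V u))
      (extChartAt (𝓡 n) p).target := by
  have hm : Set.MapsTo (fun u => (⟨(extChartAt (𝓡 n) p).symm u, V u⟩ : TangentBundle (𝓡 n) N))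
      (extChartAt (𝓡 n) p).target
      (trivializationAt (Eu n) (TangentSpace (𝓡 n)) p).source := by
    intro u hu
    rw [Bundle.Trivialization.mem_source]
    simpa using symm_mem_source hu
  rw [Bundle.Trivialization.contMDiffOn_iff (IB := 𝓡 n) hm, ← contMDiffOn_iff_contDiffOn]
  constructor
  · intro h
    exact h.2.congr fun u hu => coordVec_eq (symm_mem_source hu) (V u)
  · intro h
    exact ⟨contMDiffOn_extChartAt_symm p, h.congr fun u hu =>
      (coordVec_eq (symm_mem_source hu) (V u)).symm⟩

/-- The coordinate fields are smooth because their chart components are constant; the smooth metric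
is then evaluated on them. -/
theorem contDiffOn_riemMatrix (h : RiemMetric n N) (p : N) (i j : Fin n) :
    ContDiffOn ℝ ∞ (fun u => riemMatrix h p u i j) (extChartAt (𝓡 n) p).target := by
  have hv : ∀ a, ContMDiffOn 𝓘(ℝ, Eu n) (𝓡 n).tangent ∞
      (fun u => (⟨(extChartAt (𝓡 n) p).symm u, chartVec p u a⟩ : TangentBundle (𝓡 n) N))
      (extChartAt (𝓡 n) p).target := fun a => by
    rw [contMDiffOn_iff_coordVec]
    exact contDiffOn_const.congr fun u hu => coordVec_chartVec hu a
  have hh : ContMDiffOn 𝓘(ℝ, Eu n) ((𝓡 n).prod 𝓘(ℝ, Eu n →L[ℝ] Eu n →L[ℝ] ℝ)) ∞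
      (fun u => Bundle.TotalSpace.mk' (Eu n →L[ℝ] Eu n →L[ℝ] ℝ)
        (E := fun x : N => TangentSpace (𝓡 n) x →L[ℝ] TangentSpace (𝓡 n) x →L[ℝ] ℝ)
        ((extChartAt (𝓡 n) p).symm u) (h.inner ((extChartAt (𝓡 n) p).symm u)))
      (extChartAt (𝓡 n) p).target :=
    h.contMDiff.comp_contMDiffOn (contMDiffOn_extChartAt_symm p)
  rw [← contMDiffOn_iff_contDiffOn]
  intro u hu
  have h1 : ContMDiffWithinAt 𝓘(ℝ, Eu n) ((𝓡 n).prod 𝓘(ℝ, ℝ)) ∞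
      (fun u => Bundle.TotalSpace.mk' ℝ (E := Bundle.Trivial N ℝ) ((extChartAt (𝓡 n) p).symm u)
        (h.inner ((extChartAt (𝓡 n) p).symm u) (chartVec p u (e i)) (chartVec p u (e j))))
      (extChartAt (𝓡 n) p).target u :=
    ContMDiffWithinAt.clm_bundle_apply₂ (F₁ := Eu n) (F₂ := Eu n) (hh u hu) (hv (e i) u hu)
      (hv (e j) u hu)
  rw [Bundle.contMDiffWithinAt_totalSpace] at h1
  exact h1.2

theorem NavigationDatum.isNavOn (D : NavigationDatum n N) (p : N) :
    IsNavOn (extChartAt (𝓡 n) p).target (riemMatrix D.h p) (localField D.W p) where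
  isOpen := isOpen_extChartAt_target p
  smooth_H := contDiffOn_riemMatrix D.h p
  smooth_w := (contMDiffOn_iff_coordVec fun u => D.W ((extChartAt (𝓡 n) p).symm u)).1
    (D.smooth_W.comp_contMDiffOn (contMDiffOn_extChartAt_symm p))
  symm := fun _ _ _ _ => D.h.symm _ _ _
  pos := fun u hu y hy => by
    rw [bil_riemMatrix]
    refine D.h.pos _ _ fun h0 => hy ?_
    rw [← coordVec_chartVec hu y, h0, coordVec_zero]
  lt_one := fun u hu => by
    rw [bil_riemMatrix, localField, chartVec_coordVec hu]
    exact D.norm_W_lt_one _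

theorem RandersMetric.HasNavigationDatum.agreeOn {R : RandersMetric n N} {D : NavigationDatum n N}
    (h : R.HasNavigationDatum D) (p : N) :
    AgreeOn (extChartAt (𝓡 n) p).target (localRep R.F p)
      (navF (riemMatrix D.h p) (localField D.W p)) := by
  intro u hu y
  rw [localRep, h, navF, navLam, bil_riemMatrix, bil_riemMatrix, bil_riemMatrix, localField,
    chartVec_coordVec hu]

end Charts

end Randers
end

noncomputable section
namespace Randers

/-! ### Derivatives along curves in the submanifold -/

section Curves

variable {m : ℕ} {M : Type*} [TopologicalSpace M] [ChartedSpace (Eu m) M]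

/-- The curve through `x` with velocity `X` which is a line in the chart around `x`. -/
def chartCurve (x : M) (X : Eu m) (t : ℝ) : M :=
  (extChartAt (𝓡 m) x).symm (extChartAt (𝓡 m) x x + t • X)

theorem chartCurve_zero (x : M) (X : Eu m) : chartCurve x X 0 = x := by
  simp [chartCurve]

theorem continuousAt_chartCurve (x : M) (X : Eu m) :
    ContinuousAt (chartCurve x X) 0 := by
  refine ContinuousAt.comp_of_eq (continuousAt_extChartAt_symm (I := 𝓡 m) x)
    (hasDerivAt_line (extChartAt (𝓡 m) x x) X 0).continuousAt ?_
  simp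

theorem chartCurve_eventually_mem {x : M} (X : Eu m) {U : Set M} (hU : U ∈ 𝓝 x) :
    ∀ᶠ t in 𝓝 (0 : ℝ), chartCurve x X t ∈ U :=
  (continuousAt_chartCurve x X).preimage_mem_nhds (by rwa [chartCurve_zero])

/-- Turns manifold derivatives on `M` into one-variable derivatives, so that identities along the
submanifold can be differentiated by the calculus above. -/
theorem hasDerivAt_comp_chartCurve {n : ℕ} {f : M → Eu n} {x : M}
    (hf : MDifferentiableAt (𝓡 m) 𝓘(ℝ, Eu n) f x) (X : TangentSpace (𝓡 m) x) :
    HasDerivAt (fun t => f (chartCurve x X t))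
      (show Eu n from mfderiv (𝓡 m) 𝓘(ℝ, Eu n) f x X) 0 := by
  have h1 : HasFDerivWithinAt (writtenInExtChartAt (𝓡 m) 𝓘(ℝ, Eu n) x f)
      (show Eu m →L[ℝ] Eu n from mfderiv (𝓡 m) 𝓘(ℝ, Eu n) f x) (Set.range (𝓡 m))
      (extChartAt (𝓡 m) x x) := hf.hasMFDerivAt.2
  rw [(𝓡 m).range_eq_univ, hasFDerivWithinAt_univ] at h1
  have hline := hasDerivAt_line (extChartAt (𝓡 m) x x) (show Eu m from X) 0
  have h2 : HasFDerivAt (writtenInExtChartAt (𝓡 m) 𝓘(ℝ, Eu n) x f)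
      (show Eu m →L[ℝ] Eu n from mfderiv (𝓡 m) 𝓘(ℝ, Eu n) f x)
      (extChartAt (𝓡 m) x x + (0 : ℝ) • (show Eu m from X)) := by
    rw [zero_smul, add_zero]
    exact h1
  exact h2.comp_hasDerivAt (0 : ℝ) hline

end Curves

/-! ### Normal fields -/

section Normal

variable {n m : ℕ} {N : Type*} [TopologicalSpace N] [ChartedSpace (Eu n) N]
  {M : Type*} [TopologicalSpace M] [ChartedSpace (Eu m) M]
  {φ : M → N} {U : Set M} {ν ν' : ∀ x : M, TangentSpace (𝓡 n) (φ x)} {x : M}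

theorem mem_source_eventually (hφ : ContMDiff (𝓡 m) (𝓡 n) ∞ φ) (x : M) :
    ∀ᶠ x' in 𝓝 x, φ x' ∈ (chartAt (Eu n) (φ x)).source :=
  hφ.continuous.continuousAt.preimage_mem_nhds
    ((chartAt (Eu n) (φ x)).open_source.mem_nhds (mem_chart_source _ _))

theorem center_mem (p : N) : center p ∈ (extChartAt (𝓡 n) p).target := mem_extChartAt_target p

theorem localField_center (W : ∀ x : N, TangentSpace (𝓡 n) x) (p : N) :
    localField W p (center p) = coordVec p p (W p) :=
  localField_extChartAt W (mem_chart_source _ p)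

variable [IsManifold (𝓡 n) ∞ N]

/-- A field along `φ` is smooth if and only if it is smooth in charts. -/
theorem isSmoothFieldOn_iff (hφ : ContMDiff (𝓡 m) (𝓡 n) ∞ φ) (hU : IsOpen U) :
    IsSmoothFieldOn m φ U ν ↔ ∀ x ∈ U, ContMDiffAt (𝓡 m) 𝓘(ℝ, Eu n) ∞
      (fun x' => coordVec (φ x) (φ x') (ν x')) x := by
  refine forall₂_congr fun x hx => ?_
  have h1 : (fun x' => coordVec (φ x) (φ x') (ν x')) =ᶠ[𝓝 x] fun x' =>
      (trivializationAt (Eu n) (TangentSpace (𝓡 n)) (φ x) ⟨φ x', ν x'⟩).2 := by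
    filter_upwards [mem_source_eventually hφ x] with x' hx' using coordVec_eq hx' (ν x')
  rw [h1.contMDiffAt_iff, Bundle.contMDiffWithinAt_totalSpace]
  exact ⟨fun h => h.2.contMDiffAt (hU.mem_nhds hx), fun h =>
    ⟨hφ.contMDiffAt.contMDiffWithinAt, h.contMDiffWithinAt⟩⟩

theorem contMDiffAt_wind (D : NavigationDatum n N) (hφ : ContMDiff (𝓡 m) (𝓡 n) ∞ φ) (x : M) :
    ContMDiffAt (𝓡 m) 𝓘(ℝ, Eu n) ∞ (fun x' => coordVec (φ x) (φ x') (D.W (φ x'))) x := by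
  have h1 : IsSmoothFieldOn m φ Set.univ (fun x => D.W (φ x)) :=
    (D.smooth_W.comp hφ).contMDiffOn
  exact (isSmoothFieldOn_iff hφ isOpen_univ).1 h1 x (Set.mem_univ x)

theorem isSmoothFieldOn_add_wind (D : NavigationDatum n N) (hφ : ContMDiff (𝓡 m) (𝓡 n) ∞ φ)
    (hU : IsOpen U) (hν : IsSmoothFieldOn m φ U ν) :
    IsSmoothFieldOn m φ U (fun x => ν x + D.W (φ x)) := by
  rw [isSmoothFieldOn_iff hφ hU] at hν ⊢
  intro x hx
  simp only [coordVec_add]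
  exact (hν x hx).add (contMDiffAt_wind D hφ x)

theorem isSmoothFieldOn_sub_wind (D : NavigationDatum n N) (hφ : ContMDiff (𝓡 m) (𝓡 n) ∞ φ)
    (hU : IsOpen U) (hν : IsSmoothFieldOn m φ U ν) :
    IsSmoothFieldOn m φ U (fun x => ν x - D.W (φ x)) := by
  rw [isSmoothFieldOn_iff hφ hU] at hν ⊢
  intro x hx
  simp only [coordVec_sub]
  exact (hν x hx).sub (contMDiffAt_wind D hφ x)

variable {R : RandersMetric n N} {D : NavigationDatum n N}

theorem bil_center (h : RiemMetric n N) (p : N) (a b : TangentSpace (𝓡 n) p) :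
    bil (riemMatrix h p (center p)) (coordVec p p a) (coordVec p p b) = h.inner p a b :=
  bil_riemMatrix_coordVec h (mem_chart_source _ p) a b

theorem localRep_center (F : ∀ x : N, TangentSpace (𝓡 n) x → ℝ) (p : N)
    (y : TangentSpace (𝓡 n) p) : localRep F p (center p) (coordVec p p y) = F p y :=
  localRep_coordVec F (mem_chart_source _ p) y

/-- `F(y) = 1` if and only if `y - W` is an `h`-unit vector. -/
theorem RandersMetric.HasNavigationDatum.F_eq_one_iff (hnav : R.HasNavigationDatum D) (p : N)
    (y : TangentSpace (𝓡 n) p) :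
    R.F p y = 1 ↔ D.h.inner p (y - D.W p) (y - D.W p) = 1 := by
  rw [← localRep_center R.F p y, hnav.agreeOn p _ (center_mem p),
    ← bil_center, coordVec_sub, ← localField_center]
  exact (D.isNavOn p).navF_eq_one_iff (center_mem p)

/-- Where `F = 1` the Legendre transform is `dF`, which at `ν + W` equals `h(ν, ·)/ρ`; the constant
is `1/ρ`. -/
theorem RandersMetric.HasNavigationDatum.legendre_eq (hnav : R.HasNavigationDatum D) (p : N)
    {ν : TangentSpace (𝓡 n) p} (hν : D.h.inner p ν ν = 1) :
    ∃ c : ℝ, 0 < c ∧ ∀ v, legendre R.F p (ν + D.W p) v = c * D.h.inner p ν v := by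
  have hN := D.isNavOn p
  have hu := center_mem (n := n) p
  have hν' : bil (riemMatrix D.h p (center p)) (coordVec p p ν) (coordVec p p ν) = 1 := by
    rw [bil_center, hν]
  refine ⟨(navRho (riemMatrix D.h p) (localField D.W p) (center p)
    (coordVec p p ν + localField D.W p (center p)))⁻¹,
    inv_pos.2 (hN.rho_pos hu (hN.add_w_ne_zero hu hν')), fun v => ?_⟩
  have hF : R.F p (ν + D.W p) = 1 := by
    rw [hnav.F_eq_one_iff, add_sub_cancel_right, hν]
  have hdy := fun i => (hnav.agreeOn p).dy i (center p) hu (coordVec p p (ν + D.W p))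
  have h1 : legendre R.F p (ν + D.W p) v = DY (coordVec p p v)
      (navF (riemMatrix D.h p) (localField D.W p)) (center p) (coordVec p p (ν + D.W p)) := by
    rw [← DY_sum]
    simp only [legendre, hF, hdy, one_mul]
    exact Finset.sum_congr rfl fun i _ => mul_comm _ _
  rw [h1, coordVec_add, ← localField_center, hN.DY_F_add_w hu hν', bil_center, div_eq_inv_mul]

theorem RandersMetric.HasNavigationDatum.isFinslerNormal_add (hnav : R.HasNavigationDatum D)
    (hφ : ContMDiff (𝓡 m) (𝓡 n) ∞ φ) (hU : IsOpen U) (hν : IsRiemNormal m D.h φ U ν) :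
    IsFinslerNormal m R.F φ U (fun x => ν x + D.W (φ x)) := by
  refine ⟨isSmoothFieldOn_add_wind D hφ hU hν.1, fun x hx => ?_⟩
  obtain ⟨h1, h2⟩ := hν.2 x hx
  obtain ⟨c, -, hc⟩ := hnav.legendre_eq (φ x) h1
  refine ⟨?_, fun X => ?_⟩
  · rw [hnav.F_eq_one_iff, add_sub_cancel_right, h1]
  · rw [hc, h2, mul_zero]

theorem RandersMetric.HasNavigationDatum.isRiemNormal_sub (hnav : R.HasNavigationDatum D)
    (hφ : ContMDiff (𝓡 m) (𝓡 n) ∞ φ) (hU : IsOpen U) (hν : IsFinslerNormal m R.F φ U ν) :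
    IsRiemNormal m D.h φ U (fun x => ν x - D.W (φ x)) := by
  refine ⟨isSmoothFieldOn_sub_wind D hφ hU hν.1, fun x hx => ?_⟩
  obtain ⟨h1, h2⟩ := hν.2 x hx
  rw [hnav.F_eq_one_iff] at h1
  refine ⟨h1, fun X => ?_⟩
  obtain ⟨c, hc0, hc⟩ := hnav.legendre_eq (φ x) h1
  rw [sub_add_cancel] at hc
  have h3 := h2 X
  rw [hc] at h3
  exact (mul_eq_zero.1 h3).resolve_left hc0.ne'

/-- Both `ν - W` and `ν'` are `h`-unit, and their `h`-duals are positive multiples of one covector,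
so they are equal. -/
theorem RandersMetric.HasNavigationDatum.eq_add_of_sameConormal (hnav : R.HasNavigationDatum D)
    (hν : IsFinslerNormal m R.F φ U ν) (hν' : IsRiemNormal m D.h φ U ν')
    (h : SameConormal R.F D.h φ U ν ν') (hx : x ∈ U) : ν x = ν' x + D.W (φ x) := by
  have h1 := (hν.2 x hx).1
  have h2 := (hν'.2 x hx).1
  rw [hnav.F_eq_one_iff] at h1
  obtain ⟨c, hc0, hc⟩ := hnav.legendre_eq (φ x) h1
  rw [sub_add_cancel] at hc
  obtain ⟨d, hd0, hd⟩ := h x hx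
  set g := D.h.inner (φ x) with hg
  set v := ν x - D.W (φ x) with hv
  have h3 : ∀ z, c * g v z = d * g (ν' x) z := fun z => by rw [← hc, hd]
  have hs : g (ν' x) v = g v (ν' x) := D.h.symm _ _ _
  have e1 := h3 v
  have e2 := h3 (ν' x)
  rw [h1] at e1
  rw [h2] at e2
  rw [hs] at e1
  -- Pairing the proportionality with `v` and with `ν'` gives `c = d s` and `c s = d` for `s = h(v,
  -- ν')`; hence `c² = d²`, and both are positive.
  have hcd : c = d := by
    have e3 : c * c = d * d := by
      linear_combination c * e1 + d * e2
    exact (mul_self_inj hc0.le hd0.le).1 e3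
  subst hcd
  have e4 : g v (ν' x) = 1 := by
    apply mul_left_cancel₀ hc0.ne'
    linarith
  have e5 : v - ν' x = 0 := by
    by_contra h0
    have := D.h.pos (φ x) _ h0
    simp only [map_sub, sub_apply, ← hg] at this
    rw [h1, h2, hs, e4] at this
    norm_num at this
  rw [← sub_eq_zero.1 e5, hv, sub_add_cancel]

end Normal

end Randers
end

noncomputable section
namespace Randers

/-! ### Shape operators -/

section Shape

variable {n m : ℕ} {N : Type*} [TopologicalSpace N] [ChartedSpace (Eu n) N]
  {M : Type*} [TopologicalSpace M] [ChartedSpace (Eu m) M]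
  {φ : M → N} {U : Set M} {ν ν' : ∀ x : M, TangentSpace (𝓡 n) (φ x)} {x : M}

theorem pushVec_sub_smul (φ : M → N) (x : M) (X Y : TangentSpace (𝓡 m) x) (k : ℝ) :
    pushVec (n := n) φ x (X - k • Y) = pushVec (n := n) φ x X - k • pushVec (n := n) φ x Y := by
  have h1 : mfderiv (𝓡 m) (𝓡 n) φ x (X - k • Y)
      = mfderiv (𝓡 m) (𝓡 n) φ x X - k • mfderiv (𝓡 m) (𝓡 n) φ x Y := by
    rw [map_sub, map_smul]
  rw [pushVec, h1, coordVec_sub, coordVec_smul]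
  rfl

theorem covDeriv_eq (Γ : Fin n → Fin n → Fin n → ℝ) (φ : M → N)
    (ν : ∀ x : M, TangentSpace (𝓡 n) (φ x)) (x : M) (X : TangentSpace (𝓡 m) x) :
    covDeriv Γ φ ν x X = (show Eu n from
        mfderiv (𝓡 m) 𝓘(ℝ, Eu n) (fun x' => coordVec (φ x) (φ x') (ν x')) x X)
      + conVec Γ (pushVec (n := n) φ x X) (coordVec (φ x) (φ x) (ν x)) := by
  ext i
  rfl

variable [IsManifold (𝓡 n) ∞ N]
  {R : RandersMetric n N} {D : NavigationDatum n N}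

theorem exists_coordVec_eq (p : N) (y : Eu n) : ∃ v : TangentSpace (𝓡 n) p, coordVec p p v = y := by
  -- The point is made variable so that it can be replaced by the image of a chart point without
  -- disturbing the centre `p` of the chart.
  have key : ∀ q ∈ (chartAt (Eu n) p).source, ∃ v : TangentSpace (𝓡 n) q, coordVec p q v = y := by
    intro q hq
    obtain ⟨u, hu, rfl⟩ := exists_target hq
    exact ⟨_, coordVec_chartVec hu y⟩
  exact key p (mem_chart_source _ p)

/-- If `S = (n + 1) k F`, then the wind is homothetic. -/
theorem RandersMetric.HasNavigationDatum.killing_eq (hnav : R.HasNavigationDatum D) {k : ℝ}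
    (hS : ∀ (x : N) (y : TangentSpace (𝓡 n) x), y ≠ 0 → sCurvature R.F x y = (n + 1) * k * R.F x y)
    (p : N) (Z : Eu n) (hZ : bil (riemMatrix D.h p (center p)) Z Z = 1) :
    IsNavOn.killing (riemMatrix D.h p) (localField D.W p) (center p) Z = -2 * k := by
  have hN := D.isNavOn p
  have hu := center_mem (n := n) p
  have hy := hN.add_w_ne_zero hu hZ
  obtain ⟨v, hv⟩ := exists_coordVec_eq p (Z + localField D.W p (center p))
  have hv0 : v ≠ 0 := by
    rintro rfl
    rw [coordVec_zero] at hv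
    exact hy hv.symm
  have h1 := hS p v hv0
  have hF := hN.navF_add_w hu hZ
  rw [← localRep_center R.F p v, hv, hnav.agreeOn p _ hu, hF, sCurvature, hv,
    (hnav.agreeOn p).localS hN.isOpen hu, hN.localS_eq hu hy hF, add_sub_cancel_right] at h1
  have hn : (n : ℝ) + 1 ≠ 0 := by positivity
  have h2 : ((n : ℝ) + 1) * IsNavOn.killing (riemMatrix D.h p) (localField D.W p) (center p) Z
      = (n + 1) * (-2 * k) := by linarith
  exact mul_left_cancel₀ hn h2

/-- The components of `φ` in the chart around `φ x`. -/
def chartMap (φ : M → N) (x x' : M) : Eu n := extChartAt (𝓡 n) (φ x) (φ x')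

theorem hasDerivAt_chartMap (hφ : ContMDiff (𝓡 m) (𝓡 n) ∞ φ) (x : M)
    (X : TangentSpace (𝓡 m) x) :
    HasDerivAt (fun t => chartMap (n := n) φ x (chartCurve x X t)) (pushVec (n := n) φ x X) 0 := by
  have := isManifold_one n N
  have h1 : MDifferentiableAt (𝓡 m) (𝓡 n) φ x := hφ.contMDiffAt.mdifferentiableAt (by simp)
  have h2 : MDifferentiableAt (𝓡 n) 𝓘(ℝ, Eu n) (extChartAt (𝓡 n) (φ x)) (φ x) :=
    mdifferentiableAt_extChartAt (mem_chart_source _ _)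
  have h3 := hasDerivAt_comp_chartCurve (f := chartMap (n := n) φ x) (h2.comp x h1) X
  have h4 := congrArg (fun L => L X) (mfderiv_comp x h2 h1)
  have h5 : (show Eu n from mfderiv (𝓡 m) 𝓘(ℝ, Eu n) (chartMap (n := n) φ x) x X) = pushVec (n := n) φ x X := h4
  rwa [h5] at h3

/-- The shape operators of `F` and `h` for corresponding normal fields differ by `k`. -/
theorem isShapeOperator_iff (hnav : R.HasNavigationDatum D) (hφ : ContMDiff (𝓡 m) (𝓡 n) ∞ φ)
    (hU : IsOpen U) (hx : x ∈ U) (hν' : IsRiemNormal m D.h φ U ν')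
    (hνν' : ∀ x ∈ U, ν x = ν' x + D.W (φ x)) {k : ℝ}
    (hS : ∀ (x : N) (y : TangentSpace (𝓡 n) x), y ≠ 0 → sCurvature R.F x y = (n + 1) * k * R.F x y)
    (A : Module.End ℝ (TangentSpace (𝓡 m) x)) :
    IsShapeOperator
      (fundForm (localRep R.F (φ x)) (center (φ x)) (coordVec (φ x) (φ x) (ν x)))
      (chern (localRep R.F (φ x)) (center (φ x)) (coordVec (φ x) (φ x) (ν x))) φ ν x A
    ↔ IsShapeOperator (riemMatrix D.h (φ x) (center (φ x)))
      (christoffel (riemMatrix D.h (φ x)) (center (φ x))) φ ν' x (A - k • 1) := by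
  set p := φ x with hp
  have hN := D.isNavOn p
  have hu := center_mem (n := n) p
  have hagree := hnav.agreeOn p
  set H := riemMatrix D.h p with hH
  set w := localField D.W p with hw
  set u := center (n := n) p with hud
  set η := coordVec p p (ν' x) with hη
  obtain ⟨hn1, hn2⟩ := hν'.2 x hx
  have hη1 : bil (H u) η η = 1 := by rw [hη, hH, hud, bil_center, hn1]
  have hηp : ∀ X : TangentSpace (𝓡 m) x, bil (H u) η (pushVec (n := n) φ x X) = 0 := fun X => by
    rw [pushVec, hη, hH, hud]
    exact (bil_center D.h p _ _).trans (hn2 X)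
  have hνx : coordVec p p (ν x) = η + w u := by
    rw [hνν' x hx, coordVec_add, hw, hud, localField_center]
  have hρ := hN.rho_pos hu (hN.add_w_ne_zero hu hη1)
  rw [hagree.fundForm hu, hagree.chern hN.isOpen hu, hνx]
  have hd' := (((isSmoothFieldOn_iff hφ hU).1 hν'.1 x hx).mdifferentiableAt
    (n := ∞) (by simp))
  have hsum : (fun x' => coordVec p (φ x') (ν x')) =ᶠ[𝓝 x]
      fun x' => coordVec p (φ x') (ν' x') + coordVec p (φ x') (D.W (φ x')) := by
    filter_upwards [hU.mem_nhds hx] with x' hx'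
    rw [hνν' x' hx', coordVec_add]
  have hd : MDifferentiableAt (𝓡 m) 𝓘(ℝ, Eu n) (fun x' => coordVec p (φ x') (ν x')) x :=
    (hd'.add ((contMDiffAt_wind D hφ x).mdifferentiableAt (by simp))).congr_of_eventuallyEq hsum
  refine forall₂_congr fun X Y => ?_
  set δ : Eu n := mfderiv (𝓡 m) 𝓘(ℝ, Eu n) (fun x' => coordVec p (φ x') (ν' x')) x X with hδ
  have hcurve := hasDerivAt_comp_chartCurve hd' X
  have hψ := hasDerivAt_chartMap hφ x X
  have hc0 : chartCurve x X 0 = x := chartCurve_zero x X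
  have hψ0 : chartMap (n := n) φ x (chartCurve x X 0) = u := by
    rw [hc0]
    rfl
  have hev := (chartCurve_eventually_mem X (hU.mem_nhds hx)).and
    (chartCurve_eventually_mem X (mem_source_eventually hφ x))
  -- The wind along `φ` is the coordinate field `w` composed with `φ` in the chart, so the chain
  -- rule adds `Dw` applied to the pushed-forward vector.
  have hdν : (show Eu n from
      mfderiv (𝓡 m) 𝓘(ℝ, Eu n) (fun x' => coordVec p (φ x') (ν x')) x X)
      = δ + fderiv ℝ w u (pushVec (n := n) φ x X) := by
    have h1 := hN.hasDerivAt_w hψ (by rwa [hψ0])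
    rw [hψ0] at h1
    refine (hasDerivAt_comp_chartCurve hd X).unique
      ((hcurve.fun_add h1).congr_of_eventuallyEq ?_)
    filter_upwards [hev] with t ht
    rw [hνν' _ ht.1, coordVec_add, chartMap, hw, localField_extChartAt D.W ht.2]
  -- Differentiates `h(ν', ν') = 1` along the curve; this fixes the normal component of the
  -- derivative of `ν'`.
  have hδη : bil (H u) η δ = -(1 / 2) * bil (dmat H u (pushVec (n := n) φ x X)) η η := by
    have h1 := hasDerivAt_bil (hN.hasDerivAt_H hψ (by rwa [hψ0])) hcurve hcurve
    have h2 := (hasDerivAt_const (0 : ℝ) (1 : ℝ)).congr_of_eventuallyEq (f₁ := fun t =>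
      bil (H (chartMap (n := n) φ x (chartCurve x X t)))
        (coordVec p (φ (chartCurve x X t)) (ν' (chartCurve x X t)))
        (coordVec p (φ (chartCurve x X t)) (ν' (chartCurve x X t)))) (by
      filter_upwards [hev] with t ht
      rw [chartMap, hH, bil_riemMatrix_coordVec D.h ht.2, (hν'.2 _ ht.1).1])
    have h3 := h1.unique h2
    rw [hψ0, hc0] at h3
    change bil (dmat H u (pushVec (n := n) φ x X)) η η + bil (H u) δ η + bil (H u) η δ = 0 at h3
    rw [hN.comm hu δ η] at h3
    linarith
  have hmain := hN.bil_covDeriv hu hη1 (hηp X) (hηp Y) hδη (hnav.killing_eq hS p)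
  have hA := hN.bil_fundForm_tangent hu hη1 (hηp Y) (pushVec (n := n) φ x (A X))
  rw [hηp, zero_div, zero_mul, sub_zero] at hA
  change bil _ (pushVec (n := n) φ x (A X) + covDeriv _ φ ν x X) (pushVec (n := n) φ x Y) = 0 ↔
    bil _ (pushVec (n := n) φ x (A X - k • X) + covDeriv _ φ ν' x X) (pushVec (n := n) φ x Y) = 0
  have hR : covDeriv (christoffel H u) φ ν' x X
      = δ + conVec (christoffel H u) (pushVec (n := n) φ x X) η :=
    covDeriv_eq _ φ ν' x X
  -- Both the `A X` term and the covariant derivative carry the factor `ρ⁻¹`, so the Finsler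
  -- equation is `ρ⁻¹` times the Riemannian one for `A - k`.
  rw [covDeriv_eq, hR, hdν, hνx, bil_add_left, hA, hmain, pushVec_sub_smul,
    bil_add_left _ (_ - _), bil_sub_left, bil_smul_left, bil_add_left, ← mul_add, mul_eq_zero,
    or_iff_right (inv_pos.2 hρ).ne']
  constructor <;> intro h0 <;> linarith

/-- Subtracting the scalar `k` substitutes `X + k` into the characteristic polynomial, which moves
each root by `-k` and keeps multiplicities. -/
theorem charpoly_sub_smul_eq {V : Type*} [AddCommGroup V] [Module ℝ V] [Module.Finite ℝ V]
    (A : Module.End ℝ V) (k : ℝ) {lam : Fin m → ℝ}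
    (h : A.charpoly = ∏ a, (Polynomial.X - Polynomial.C (lam a))) :
    (A - k • 1).charpoly = ∏ a, (Polynomial.X - Polynomial.C (lam a - k)) := by
  rw [LinearMap.charpoly_sub_smul, h, Polynomial.prod_comp]
  refine Finset.prod_congr rfl fun a _ => ?_
  simp only [Polynomial.sub_comp, Polynomial.X_comp, Polynomial.C_comp, Polynomial.C_sub]
  ring

/-- The principal curvatures of `F` and `h` for corresponding normal fields differ by `k`. -/
theorem finslerPrincipalCurvatures_iff (hnav : R.HasNavigationDatum D)
    (hφ : ContMDiff (𝓡 m) (𝓡 n) ∞ φ) (hU : IsOpen U) (hx : x ∈ U)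
    (hν' : IsRiemNormal m D.h φ U ν') (hνν' : ∀ x ∈ U, ν x = ν' x + D.W (φ x)) {k : ℝ}
    (hS : ∀ (x : N) (y : TangentSpace (𝓡 n) x), y ≠ 0 → sCurvature R.F x y = (n + 1) * k * R.F x y)
    (lam : Fin m → ℝ) :
    FinslerPrincipalCurvatures R.F φ ν x lam
      ↔ RiemPrincipalCurvatures D.h φ ν' x (fun a => lam a - k) := by
  constructor
  · rintro ⟨A, hA, hc⟩
    exact ⟨A - k • (1 : Module.End ℝ (TangentSpace (𝓡 m) x)),
      (isShapeOperator_iff hnav hφ hU hx hν' hνν' hS A).1 hA, charpoly_sub_smul_eq A k hc⟩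
  · rintro ⟨B, hB, hc⟩
    -- The Finsler operator is `B + k`, written as `B - (-k)` so that `charpoly_sub_smul_eq` also
    -- covers this direction.
    have h1 : B - (-k) • (1 : Module.End ℝ (TangentSpace (𝓡 m) x)) - k • 1 = B := by
      rw [neg_smul, sub_neg_eq_add, add_sub_cancel_right]
    refine ⟨B - (-k) • (1 : Module.End ℝ (TangentSpace (𝓡 m) x)),
      (isShapeOperator_iff hnav hφ hU hx hν' hνν' hS _).2 (by rwa [h1]), ?_⟩
    have h2 := charpoly_sub_smul_eq B (-k) hc
    simpa only [sub_neg_eq_add, sub_add_cancel] using h2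

theorem finslerConstantAlong_iff (hnav : R.HasNavigationDatum D)
    (hφ : ContMDiff (𝓡 m) (𝓡 n) ∞ φ) (hU : IsOpen U)
    (hν' : IsRiemNormal m D.h φ U ν') (hνν' : ∀ x ∈ U, ν x = ν' x + D.W (φ x)) {k : ℝ}
    (hS : ∀ (x : N) (y : TangentSpace (𝓡 n) x), y ≠ 0 → sCurvature R.F x y = (n + 1) * k * R.F x y) :
    FinslerConstantAlong m R.F φ U ν ↔ RiemConstantAlong m D.h φ U ν' := by
  constructor
  · rintro ⟨lam, h⟩
    exact ⟨fun a => lam a - k, fun x hx =>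
      (finslerPrincipalCurvatures_iff hnav hφ hU hx hν' hνν' hS lam).1 (h x hx)⟩
  · rintro ⟨lam, h⟩
    refine ⟨fun a => lam a + k, fun x hx =>
      (finslerPrincipalCurvatures_iff hnav hφ hU hx hν' hνν' hS _).2 ?_⟩
    simpa only [add_sub_cancel_right] using h x hx

end Shape

end Randers

end

/-! ### The main theorem -/

theorem mainTheorem6 {n m : ℕ} (hm : 1 ≤ m) (hmn : m < n)
    {N : Type*} [TopologicalSpace N] [ChartedSpace (EuclideanSpace ℝ (Fin n)) N]
    [IsManifold (𝓡 n) ∞ N]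
    {M : Type*} [TopologicalSpace M] [ChartedSpace (EuclideanSpace ℝ (Fin m)) M]
    [IsManifold (𝓡 m) ∞ M]
    (R : Randers.RandersMetric n N) (D : Randers.NavigationDatum n N)
    (hnav : R.HasNavigationDatum D)
    (φ : M → N) (hφ : Randers.IsImmersed n m φ) :
    (Randers.HasConstantSCurvature R.F →
      (∀ (U : Set M) (ν ν' : ∀ x : M, TangentSpace (𝓡 n) (φ x)), IsOpen U →
        Randers.IsFinslerNormal m R.F φ U ν →
        Randers.IsRiemNormal m D.h φ U ν' →
        Randers.SameConormal R.F D.h φ U ν ν' →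
        (Randers.FinslerConstantAlong m R.F φ U ν ↔
          Randers.RiemConstantAlong m D.h φ U ν')) ∧
      (Randers.FinslerAllConstant m R.F φ ↔
        Randers.RiemAllConstant m D.h φ)) ∧
    (Randers.HasVanishingSCurvature R.F →
      (Randers.IsAnisotropicMinimal m R.F φ ↔
        Randers.IsRiemMinimal m D.h φ)) := by
  have hs := hφ.1
  refine ⟨?_, fun hS => ?_⟩
  · rintro ⟨k, hS⟩
    refine ⟨fun U ν ν' hU hν hν' hc => Randers.finslerConstantAlong_iff hnav hs hU hν'
      (fun x hx => hnav.eq_add_of_sameConormal hν hν' hc hx) hS, fun h U ν' hU hUc hν' => ?_,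
      fun h U ν hU hUc hν => ?_⟩
    · exact (Randers.finslerConstantAlong_iff hnav hs hU hν' (fun x _ => rfl) hS).1
        (h U _ hU hUc (hnav.isFinslerNormal_add hs hU hν'))
    · have hν' := hnav.isRiemNormal_sub hs hU hν
      exact (Randers.finslerConstantAlong_iff hnav hs hU hν' (fun x _ => by simp) hS).2
        (h U _ hU hUc hν')
  -- Vanishing S-curvature is the case `k = 0`: corresponding normals then have the same principal
  -- curvatures, hence the same sum.
  · have hS' : ∀ (x : N) (y : TangentSpace (𝓡 n) x), y ≠ 0 →
        Randers.sCurvature R.F x y = (n + 1) * 0 * R.F x y := fun x y hy => by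
      rw [hS x y hy, mul_zero, zero_mul]
    refine ⟨fun h U ν' hU hν' x hx => ?_, fun h U ν hU hν x hx => ?_⟩
    · obtain ⟨lam, h1, h2⟩ := h U _ hU (hnav.isFinslerNormal_add hs hU hν') x hx
      refine ⟨lam, ?_, h2⟩
      simpa only [sub_zero] using (Randers.finslerPrincipalCurvatures_iff hnav hs hU hx hν'
        (fun x _ => rfl) hS' lam).1 h1
    · have hν' := hnav.isRiemNormal_sub hs hU hν
      obtain ⟨lam, h1, h2⟩ := h U _ hU hν' x hx
      refine ⟨lam, ?_, h2⟩
      exact (Randers.finslerPrincipalCurvatures_iff hnav hs hU hx hν' (fun x _ => by simp) hS'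
        lam).2 (by simpa only [sub_zero] using h1)
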